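/- Let $\mathbb T^2=\mathbb R^2/\mathbb Z^2$ with coordinates $(\theta,r)$ and Lebesgue measure $\mu$. For $\rho>0$ let $A^\rho=\{(\theta,r)\in\mathbb C^2: |\operatorname{Im}\theta|<\rho,\ |\operatorname{Im} r|<\rho\}$, and for a $\mathbb Z^2$-periodic function $u:\mathbb R^2\to\mathbb R$ that extends holomorphically to $A^\rho$ let $\|u\|_\rho$ be the supremum over $A^\rho$ of the modulus of the extension. Let $\mathrm{Diff}^\omega_\rho$ be the set of real-analytic diffeomorphisms of $\mathbb T^2$, homotopic to the identity, having a lift $(\theta+f_1(\theta,r),\,r+f_2(\theta,r))$ where $f_1,f_2$ are $\mathbb Z^2$-periodic, extend holomorphically to $A^\rho$, and satisfy $\|f_1\|_\rho,\|f_2\|_\rho<\infty$; for $F,G\in\mathrm{Diff}^\omega_\rho$, with lifts given by $(f_1,f_2)$ and $(g_1,g_2)$, put $$d_\rho(F,G)=\max_{i=1,2}\ \inf_{p\in\mathbb Z}\|f_i-g_i+p\|_\rho .$$ Theorem. Let $\alpha\in\mathbb R$ and $\delta>0$ be such that $$|\alpha-p/q|<\exp(-q^{1+\delta})$$ has infinitely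 many solutions $(p,q)$ with $p\in\mathbb Z$, $q\ge1$ coprime, and let $0<\sigma<\min\{\delta/3,1\}$. Then for every $\rho>0$ and every sequence of pairwise distinct solutions there is a subsequence $(p_n,q_n)_{n\ge0}$ of it, with $q_n$ strictly increasing and $|\alpha-p_n/q_n|$ strictly decreasing, such that the following holds. Put $\alpha_n=p_n/q_n$, $R_t(\theta,r)=(\theta+t,r)$ and, for $n\ge1$, $$\phi_n(\theta,r)=(\theta,\ r+q_n^2\cos(2\pi q_n\theta)),\qquad g_n(\theta,r)=(\theta+[nq_n^\sigma]\,r,\ r),\qquad h_n=g_n\circ\phi_n,$$ where $[\cdot]$ is the integer part; put $H_n=h_1\circ\dots\circ h_n$ (with $H_0=\mathrm{id}$) and, for $n\ge0$, $f_n=H_n\circ R_{\alpha_{n+1}}\circ H_n^{-1}$. Then all $f_n$ lie in $\mathrm{Diff}^\omega_\rho$, and there is $f\in\mathrm{Diff}^\omega_\rho$ with $d_\rho(f_n,f)\to0$ such that $f$ preserves $\mu$ and is weak mixing: every measurable $h:\mathbb T^2\to\mathbb C$ with $h\circ f=\lambda h$ $\mu$-almost everywhere for some constant $\lambda\in\mathbb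 C$ is $\mu$-almost everywhere constant. -/

import Mathlib

open MeasureTheory Filter Topology
open scoped ENNReal

noncomputable section

namespace TorusConj

/-- The torus `𝕋² = ℝ²/ℤ²`, with coordinates `(θ, r)`. Its `volume` is the product of the
normalized Lebesgue measures on the circles. -/
abbrev Torus : Type := UnitAddCircle × UnitAddCircle

/-- The covering projection `ℝ² → 𝕋²`. -/
def proj (x : ℝ × ℝ) : Torus := ((x.1 : UnitAddCircle), (x.2 : UnitAddCircle))

/-! ### The explicit maps -/

theorem cos_periodic (q : ℕ) :
    Function.Periodic (fun θ : ℝ => Real.cos (2 * Real.pi * q * θ)) (1 : ℝ) := by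
  intro θ
  have h : 2 * Real.pi * q * (θ + 1) = 2 * Real.pi * q * θ + (q : ℕ) * (2 * Real.pi) := by ring
  simp only [h, Real.cos_add_nat_mul_two_pi]

/-- `θ ↦ cos (2πqθ)` as a function on the circle `ℝ/ℤ`. -/
def circleCos (q : ℕ) : UnitAddCircle → ℝ := (cos_periodic q).lift

/-- The action `R_t (θ, r) = (θ + t, r)`. -/
def rot (t : ℝ) : Equiv.Perm Torus where
  toFun x := (x.1 + (t : UnitAddCircle), x.2)
  invFun x := (x.1 - (t : UnitAddCircle), x.2)
  left_inv x := by simp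
  right_inv x := by simp

/-- `φ (θ, r) = (θ, r + q² cos (2πqθ))`. -/
def phi (q : ℕ) : Equiv.Perm Torus where
  toFun x := (x.1, x.2 + (((q : ℝ) ^ 2 * circleCos q x.1 : ℝ) : UnitAddCircle))
  invFun x := (x.1, x.2 - (((q : ℝ) ^ 2 * circleCos q x.1 : ℝ) : UnitAddCircle))
  left_inv x := by simp
  right_inv x := by simp

/-- The shear `(θ, r) ↦ (θ + b r, r)` for an integer `b`. -/
def shear (b : ℤ) : Equiv.Perm Torus where
  toFun x := (x.1 + b • x.2, x.2)
  invFun x := (x.1 - b • x.2, x.2)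
  left_inv x := by simp
  right_inv x := by simp

/-- `h_n = g_n ∘ φ_n`, where `g_n (θ, r) = (θ + [n q_n^σ] r, r)`. -/
def hMap (σ : ℝ) (q : ℕ → ℕ) (n : ℕ) : Equiv.Perm Torus :=
  shear ⌊(n : ℝ) * (q n : ℝ) ^ σ⌋ * phi (q n)

/-- `H_n = h_1 ∘ ⋯ ∘ h_n` (so `H_0` is the identity). -/
def HMap (σ : ℝ) (q : ℕ → ℕ) : ℕ → Equiv.Perm Torus
  | 0 => 1
  | n + 1 => HMap σ q n * hMap σ q (n + 1)

/-- `f_n = H_n ∘ R_{α_{n+1}} ∘ H_n⁻¹`, where `α_n = p_n / q_n`. -/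
def fMap (σ : ℝ) (p : ℕ → ℤ) (q : ℕ → ℕ) (n : ℕ) : Equiv.Perm Torus :=
  HMap σ q n * rot ((p (n + 1) : ℝ) / (q (n + 1) : ℝ)) * (HMap σ q n)⁻¹

/-! ### The analytic topology -/

/-- `u = (f₁, f₂)` is the displacement of a lift `(θ + f₁(θ,r), r + f₂(θ,r))` of `F : 𝕋² → 𝕋²`:
`u` is continuous, `ℤ²`-periodic, and `x ↦ x + u x` covers `F`. Such a `u` exists exactly when
`F` is continuous and homotopic to the identity, and is then unique up to adding a vector
of `ℤ²`. -/
structure IsDisplacement (F : Torus → Torus) (u : ℝ × ℝ → ℝ × ℝ) : Prop where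
  continuous : Continuous u
  periodic : ∀ (x : ℝ × ℝ) (a b : ℤ), u (x + ((a : ℝ), (b : ℝ))) = u x
  covers : ∀ x : ℝ × ℝ, proj (x + u x) = F (proj x)

/-- The complex strip `A^ρ = {|Im θ| < ρ, |Im r| < ρ} ⊆ ℂ²`. -/
def strip (ρ : ℝ) : Set (ℂ × ℂ) := {z | |z.1.im| < ρ ∧ |z.2.im| < ρ}

/-- `U` is a holomorphic extension of `u : ℝ² → ℝ` to the strip `A^ρ`. -/
structure IsHolExtension (ρ : ℝ) (u : ℝ × ℝ → ℝ) (U : ℂ × ℂ → ℂ) : Prop where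
  holomorphic : DifferentiableOn ℂ U (strip ρ)
  extends_real : ∀ x : ℝ × ℝ, U ((x.1 : ℂ), (x.2 : ℂ)) = (u x : ℂ)

/-- `‖u‖_ρ`, the supremum over `A^ρ` of the modulus of the holomorphic extension of `u`.
For `ρ > 0` the extension is unique on `A^ρ` if it exists, so that the infimum is over at most one
value; it is `∞` if there is no extension. -/
def rhoNorm (ρ : ℝ) (u : ℝ × ℝ → ℝ) : ℝ≥0∞ :=
  ⨅ (U : ℂ × ℂ → ℂ) (_ : IsHolExtension ρ u U), ⨆ z ∈ strip ρ, ‖U z‖ₑ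

/-- `F` is a real-analytic diffeomorphism of `𝕋²` homotopic to the identity. -/
def IsAnalyticDiffeo (F : Equiv.Perm Torus) : Prop :=
  (∃ u, IsDisplacement F u ∧ AnalyticOnNhd ℝ u Set.univ) ∧
    ∃ v, IsDisplacement F.symm v ∧ AnalyticOnNhd ℝ v Set.univ

/-- The space `Diff^ω_ρ`: real-analytic diffeomorphisms homotopic to the identity, with a lift
`(θ + f₁, r + f₂)` such that `‖f₁‖_ρ < ∞` and `‖f₂‖_ρ < ∞`. -/
def IsRhoDiffeo (ρ : ℝ) (F : Equiv.Perm Torus) : Prop :=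
  IsAnalyticDiffeo F ∧
    ∃ u, IsDisplacement F u ∧
      rhoNorm ρ (fun x => (u x).1) < ∞ ∧ rhoNorm ρ (fun x => (u x).2) < ∞

/-- `d_ρ(F, G) = max_{i=1,2} inf_{p ∈ ℤ} ‖f_i - g_i + p‖_ρ`, where `(f₁, f₂)` and `(g₁, g₂)` are
the displacements of lifts of `F` and `G`. The value does not depend on the lifts, so that the
outer infimum is over at most one value. -/
def rhoDist (ρ : ℝ) (F G : Equiv.Perm Torus) : ℝ≥0∞ :=
  ⨅ (u : ℝ × ℝ → ℝ × ℝ) (v : ℝ × ℝ → ℝ × ℝ) (_ : IsDisplacement F u) (_ : IsDisplacement G v),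
    max (⨅ p : ℤ, rhoNorm ρ (fun x => (u x).1 - (v x).1 + p))
      (⨅ p : ℤ, rhoNorm ρ (fun x => (u x).2 - (v x).2 + p))

/-! ### Weak mixing -/

/-- A transformation `T` preserving `μ` is weak mixing if it has no nonconstant measurable
eigenfunction (equality of functions being almost everywhere). -/
def IsWeakMixing {X : Type*} [MeasurableSpace X] (T : X → X) (μ : Measure X) : Prop :=
  MeasurePreserving T μ μ ∧
    ∀ (l : ℂ) (h : X → ℂ), Measurable h → (∀ᵐ x ∂μ, h (T x) = l * h x) →
      ∃ c : ℂ, ∀ᵐ x ∂μ, h x = c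

end TorusConj

end

open TorusConj

/-! ### Osgood's lemma -/

/-! This is approximation by conjugation. Shears commute with every rotation, and the fibre twist
`phi q` commutes with rotation by any multiple of `1/q`. Hence `h_{n+1}` commutes with the powers of
`R_{α_{n+1}}`, and passing from `H_n R_{mα_{n+1}} H_n⁻¹` to `H_{n+1} R_{mα_{n+2}} H_{n+1}⁻¹` costs
only what the change from `mα_{n+1}` to `mα_{n+2}` costs. In the explicit formula for `h R_t h⁻¹`
(`conj_rotC_apply`) the cosine is evaluated at `θ - b r`, with `b` of size `n q^σ`. On a complex
strip the loss is therefore of order `exp(C q^(1+σ))`, while `|α_{n+2} - α_{n+1}|` is at most `2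
exp(-q^(1+δ))`. The outer map `H_n` is fixed before `q = q_{n+1}` is chosen, so its Lipschitz
constants are harmless for large `q` (`eventually_perturbation`). The estimate holds uniformly for
`|m| ≤ q_{n+1}`. The cases `m = 1` and `m = -1` give the limit `f` and its inverse, with holomorphic
lifts on the strip. The other `m` show that `f^m` stays close to `H_n R_{mα_{n+1}} H_n⁻¹`
(`exists_limit`).

For weak mixing, choose `m ≤ q_{n+2}` with `m α_{n+2}` close to `1/(2 q_{n+1})` modulo 1. Then `f^m`
is close to `H_n (h R_{1/(2q)} h⁻¹) H_n⁻¹` with `h = h_{n+1}` and `q = q_{n+1}`. A half-period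
translation changes the sign of `cos(2πqθ)`, so up to the shear this map moves `r` by `-2 q²
cos(2πqθ)`. Its correlations on characters are either zero or integrals of `exp(2πi M cos(2πs))`
with `|M| → ∞`, which vanish in the limit by Riemann–Lebesgue (`integral_character_halfShift`,
`tendsto_correlation_character`). Density of trigonometric polynomials extends the decay to
continuous functions. Decay along one sequence of iterates already excludes nonconstant
eigenfunctions (`isWeakMixing_of_correlation`).

Each requirement on the next index holds for all large indices, given those already chosen, so a
recursion produces the subsequence (`exists_admissible`, `exists_dependent_seq`). Osgood's lemma
supplies real analyticity from complex differentiability on a strip, and holomorphy of uniform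
limits in two variables. -/

namespace Osgood

/-- The contour integral over `C(c, R)` as a functional on `C(sphere c R, ℂ)`. -/
noncomputable def contour (c : ℂ) {R : ℝ} (hR : 0 ≤ R) : C(Metric.sphere c R, ℂ) →L[ℂ] ℂ :=
  LinearMap.mkContinuous
    { toFun := fun φ => ∫ θ in (0 : ℝ)..2 * Real.pi,
        deriv (circleMap c R) θ * φ ⟨circleMap c R θ, circleMap_mem_sphere c hR θ⟩
      map_add' := by
        intro φ ψ
        simp only [ContinuousMap.add_apply, mul_add]
        apply intervalIntegral.integral_add <;>
        · apply Continuous.intervalIntegrable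
          simp only [deriv_circleMap]
          fun_prop
      map_smul' := by
        intro m φ
        simp only [ContinuousMap.smul_apply, smul_eq_mul, RingHom.id_apply]
        rw [← intervalIntegral.integral_const_mul]
        congr 1
        ext θ
        ring }
    (R * |2 * Real.pi - 0|) (by
      intro φ
      have := intervalIntegral.norm_integral_le_of_norm_le_const (a := (0 : ℝ)) (b := 2 * Real.pi)
        (f := fun θ => deriv (circleMap c R) θ *
          φ ⟨circleMap c R θ, circleMap_mem_sphere c hR θ⟩) (C := R * ‖φ‖) (by
          intro θ _
          rw [norm_mul]
          have h1 : ‖deriv (circleMap c R) θ‖ = R := by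
            simp [deriv_circleMap, abs_of_nonneg hR]
          rw [h1]
          exact mul_le_mul_of_nonneg_left (φ.norm_coe_le_norm _) hR)
      refine this.trans (le_of_eq ?_)
      ring)

theorem contour_apply (c : ℂ) {R : ℝ} (hR : 0 ≤ R) (φ : C(Metric.sphere c R, ℂ)) (f : ℂ → ℂ)
    (h : ∀ ζ : Metric.sphere c R, φ ζ = f ζ) : contour c hR φ = ∮ ζ in C(c, R), f ζ := by
  simp only [contour, circleIntegral, LinearMap.mkContinuous_apply, LinearMap.coe_mk,
    AddHom.coe_mk, smul_eq_mul, h]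

/-- Cauchy's formula is applied in one variable at a time, with values in the Banach algebra
`C(sphere c R, ℂ)`. The slice `z ↦ U(z, ·)` is analytic as a vector-valued Cauchy integral, and `w ↦
(ζ - w)⁻¹` is analytic because inversion is analytic at units. Then `U` is a continuous linear
functional of the product of the two. -/
theorem analyticAt_aux {U : ℂ × ℂ → ℂ} {a c : ℂ} {R : ℝ} (hR : 0 < R)
    (hc : ContinuousOn U (Metric.closedBall a R ×ˢ Metric.closedBall c R))
    (h1 : ∀ w ∈ Metric.closedBall c R,
      DifferentiableOn ℂ (fun z => U (z, w)) (Metric.closedBall a R))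
    (h2 : ∀ z ∈ Metric.closedBall a R,
      DifferentiableOn ℂ (fun w => U (z, w)) (Metric.closedBall c R)) :
    AnalyticAt ℂ U (a, c) := by
  classical
  have sa := Metric.sphere_subset_closedBall (x := a) (ε := R)
  have sc := Metric.sphere_subset_closedBall (x := c) (ε := R)
  let V : C(Metric.sphere a R × Metric.sphere c R, ℂ) :=
    ⟨fun x => U (x.1, x.2), by
      apply hc.comp_continuous (by fun_prop)
      intro x
      exact ⟨sa x.1.2, sc x.2.2⟩⟩
  -- The circle integral needs an integrand on all of `ℂ`; the value `0` off the circle never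
  -- enters.
  let K : ℂ → C(Metric.sphere c R, ℂ) := fun ζ =>
    if h : ζ ∈ Metric.sphere a R then V.curry ⟨ζ, h⟩ else 0
  have hK : ContinuousOn K (Metric.sphere a R) := by
    rw [continuousOn_iff_continuous_domRestrict]
    have : (Metric.sphere a R).domRestrict K = V.curry := by
      ext1 ζ
      have := ζ.2
      simp only [Set.domRestrict_apply, K, dif_pos this]
    rw [this]
    exact V.curry.continuous
  have hKi : CircleIntegrable K a R := hK.circleIntegrable hR.le
  let G : ℂ → C(Metric.sphere c R, ℂ) := fun z =>
    (2 * Real.pi * Complex.I : ℂ)⁻¹ • ∮ ζ in C(a, R), (ζ - z)⁻¹ • K ζ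
  have hG : AnalyticAt ℂ G a := by
    lift R to NNReal using hR.le
    exact (hasFPowerSeriesOn_cauchy_integral hKi (by exact_mod_cast hR)).analyticAt
  have hGv : ∀ z ∈ Metric.ball a R, ∀ ζ : Metric.sphere c R, G z ζ = U (z, ζ) := by
    intro z hz ζ
    have hi : CircleIntegrable (fun ζ => (ζ - z)⁻¹ • K ζ) a R := by
      apply ContinuousOn.circleIntegrable hR.le
      refine ContinuousOn.smul (ContinuousOn.inv₀ (f := fun ζ => ζ - z) (by fun_prop) ?_) hK
      intro x hx h0
      rw [sub_eq_zero] at h0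
      subst h0
      simp only [Metric.mem_ball, Metric.mem_sphere] at hx hz
      linarith
    have e := ContinuousLinearMap.intervalIntegral_comp_comm
      (ContinuousMap.evalCLM ℂ ζ : C(Metric.sphere c R, ℂ) →L[ℂ] ℂ) hi.out
    have key := Complex.two_pi_I_inv_smul_circleIntegral_sub_inv_smul_of_differentiable_on_off_countable
      (s := ∅) Set.countable_empty hz (h1 ζ (sc ζ.2)).continuousOn
      (fun x hx => ((h1 ζ (sc ζ.2)).differentiableAt
        (Filter.mem_of_superset (Metric.isOpen_ball.mem_nhds hx.1) Metric.ball_subset_closedBall)))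
    rw [← key]
    simp only [G, ContinuousMap.smul_apply]
    congr 1
    simp only [circleIntegral]
    refine Eq.trans e.symm ?_
    apply intervalIntegral.integral_congr
    intro θ _
    have hm : circleMap a R θ ∈ Metric.sphere a R := circleMap_mem_sphere a hR.le θ
    simp only [K, dif_pos hm, V, ContinuousMap.evalCLM_apply, ContinuousMap.smul_apply,
      ContinuousMap.curry_apply, ContinuousMap.coe_mk]
  let ι : C(Metric.sphere c R, ℂ) := ⟨fun ζ => ζ, by fun_prop⟩
  let L : ℂ → C(Metric.sphere c R, ℂ) := fun w => Ring.inverse (ι - algebraMap ℂ _ w)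
  have hal : ∀ (w : ℂ) (ζ : Metric.sphere c R), algebraMap ℂ C(Metric.sphere c R, ℂ) w ζ = w :=
    fun _ _ => rfl
  have hu : ∀ w ∈ Metric.ball c R, IsUnit (ι - algebraMap ℂ _ w) := by
    intro w hw
    rw [ContinuousMap.isUnit_iff_forall_ne_zero]
    intro ζ
    simp only [ContinuousMap.sub_apply, ι, ContinuousMap.coe_mk, hal]
    intro h0
    rw [sub_eq_zero] at h0
    have := ζ.2
    rw [h0, Metric.mem_sphere] at this
    rw [Metric.mem_ball] at hw
    linarith
  have hLv : ∀ w ∈ Metric.ball c R, ∀ ζ : Metric.sphere c R, L w ζ = ((ζ : ℂ) - w)⁻¹ := by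
    intro w hw ζ
    have h := Ring.mul_inverse_cancel _ (hu w hw)
    have h' := congrArg (fun φ : C(Metric.sphere c R, ℂ) => φ ζ) h
    simp only [ContinuousMap.mul_apply, ContinuousMap.sub_apply, ι, ContinuousMap.coe_mk,
      hal, ContinuousMap.one_apply] at h'
    exact eq_inv_of_mul_eq_one_right h'
  have hL : AnalyticAt ℂ L c := by
    obtain ⟨u, hu'⟩ := hu c (Metric.mem_ball_self hR)
    have h3 := analyticAt_inverse (𝕜 := ℂ) u
    rw [hu'] at h3
    refine AnalyticAt.comp (f := fun w => ι - algebraMap ℂ _ w) h3 ?_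
    exact analyticAt_const.sub ((Algebra.linearMap ℂ C(Metric.sphere c R, ℂ)).toContinuousLinearMap.analyticAt c)
  have hA : AnalyticAt ℂ (fun x : ℂ × ℂ => (2 * Real.pi * Complex.I : ℂ)⁻¹ *
      contour c hR.le (L x.2 * G x.1)) (a, c) := by
    refine analyticAt_const.mul ?_
    refine ((contour c hR.le).analyticAt _).comp ?_
    exact (AnalyticAt.comp (x := (a, c)) (f := Prod.snd) hL analyticAt_snd).mul
      (AnalyticAt.comp (x := (a, c)) (f := Prod.fst) hG analyticAt_fst)
  refine hA.congr ?_
  have hn : Metric.ball a R ×ˢ Metric.ball c R ∈ 𝓝 (a, c) :=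
    prod_mem_nhds (Metric.ball_mem_nhds a hR) (Metric.ball_mem_nhds c hR)
  filter_upwards [hn] with x hx
  have hza := Metric.ball_subset_closedBall hx.1
  have key := Complex.two_pi_I_inv_smul_circleIntegral_sub_inv_smul_of_differentiable_on_off_countable
      (s := ∅) Set.countable_empty hx.2 (h2 x.1 hza).continuousOn
      (fun y hy => ((h2 x.1 hza).differentiableAt
        (Filter.mem_of_superset (Metric.isOpen_ball.mem_nhds hy.1) Metric.ball_subset_closedBall)))
  rw [contour_apply c hR.le _ (fun ζ => (ζ - x.2)⁻¹ • U (x.1, ζ))]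
  · exact key
  · intro ζ
    rw [ContinuousMap.mul_apply, hLv _ hx.2, hGv _ hx.1, smul_eq_mul]

end Osgood

/-- **Osgood's lemma** in two variables: a continuous separately holomorphic function is
analytic. -/
theorem analyticOnNhd_of_separately_differentiable {U : ℂ × ℂ → ℂ} {s : Set (ℂ × ℂ)}
    (hs : IsOpen s) (hc : ContinuousOn U s)
    (h1 : ∀ x ∈ s, DifferentiableAt ℂ (fun z => U (z, x.2)) x.1)
    (h2 : ∀ x ∈ s, DifferentiableAt ℂ (fun w => U (x.1, w)) x.2) : AnalyticOnNhd ℂ U s := by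
  rintro ⟨a, c⟩ hx
  obtain ⟨R, hR, hRs⟩ := Metric.nhds_basis_closedBall.mem_iff.1 (hs.mem_nhds hx)
  rw [← closedBall_prod_same] at hRs
  exact Osgood.analyticAt_aux hR (hc.mono hRs)
    (fun w hw z hz => (h1 (z, w) (hRs ⟨hz, hw⟩)).differentiableWithinAt)
    (fun z hz w hw => (h2 (z, w) (hRs ⟨hz, hw⟩)).differentiableWithinAt)

namespace TorusConj

/-! ### Complex lifts -/

/-- The inclusion `ℝ² → ℂ²`. -/
def toC (x : ℝ × ℝ) : ℂ × ℂ := ((x.1 : ℂ), (x.2 : ℂ))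

/-- The inclusion `ℤ² → ℂ²`. -/
def intC (v : ℤ × ℤ) : ℂ × ℂ := ((v.1 : ℂ), (v.2 : ℂ))

theorem toC_injective : Function.Injective toC := by
  rintro ⟨a, b⟩ ⟨c, d⟩ h
  simpa [toC] using h

theorem continuous_toC : Continuous toC := by
  unfold toC
  fun_prop

theorem norm_toC_sub (x y : ℝ × ℝ) : ‖toC x - toC y‖ = ‖x - y‖ := by
  simp only [toC, Prod.norm_def, Prod.fst_sub, Prod.snd_sub, ← Complex.ofReal_sub,
    Complex.norm_real]

theorem toC_mem_strip {R : ℝ} (hR : 0 < R) (x : ℝ × ℝ) : toC x ∈ strip R := by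
  simp [toC, strip, hR]

theorem add_intC_mem_strip {R : ℝ} {z : ℂ × ℂ} (hz : z ∈ strip R) (v : ℤ × ℤ) :
    z + intC v ∈ strip R := by
  simpa [strip, intC] using hz

theorem isOpen_strip (R : ℝ) : IsOpen (strip R) := by
  have h1 : Continuous fun z : ℂ × ℂ => |z.1.im| :=
    continuous_abs.comp (Complex.continuous_im.comp continuous_fst)
  have h2 : Continuous fun z : ℂ × ℂ => |z.2.im| :=
    continuous_abs.comp (Complex.continuous_im.comp continuous_snd)
  exact (isOpen_lt h1 continuous_const).inter (isOpen_lt h2 continuous_const)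

theorem proj_surjective : Function.Surjective proj := by
  rintro ⟨a, b⟩
  obtain ⟨x, rfl⟩ := QuotientAddGroup.mk_surjective a
  obtain ⟨y, rfl⟩ := QuotientAddGroup.mk_surjective b
  exact ⟨(x, y), rfl⟩

theorem dist_proj_le (x y : ℝ × ℝ) : dist (proj x) (proj y) ≤ ‖x - y‖ := by
  have h : ∀ a b : ℝ, dist (a : UnitAddCircle) (b : UnitAddCircle) ≤ ‖a - b‖ := by
    intro a b
    rw [dist_eq_norm, ← AddCircle.coe_sub]
    exact QuotientAddGroup.norm_mk_le_norm
  rw [Prod.dist_eq, Prod.norm_def]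
  exact max_le_max (h _ _) (h _ _)

theorem continuous_proj : Continuous proj :=
  LipschitzWith.continuous (K := 1) <| LipschitzWith.of_dist_le_mul fun x y => by
    simpa [dist_eq_norm] using dist_proj_le x y

/-- `C` is an entire lift of `F : 𝕋² → 𝕋²` to `ℂ²`, Lipschitz on every strip. -/
structure IsLift (F : Torus → Torus) (C : ℂ × ℂ → ℂ × ℂ) : Prop where
  differentiable : Differentiable ℂ C
  real : ∀ x : ℝ × ℝ, ∃ y : ℝ × ℝ, C (toC x) = toC y ∧ proj y = F (proj x)
  equivariant : ∃ A : ℤ × ℤ → ℤ × ℤ, ∀ z v, C (z + intC v) = C z + intC (A v)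
  lipschitz : ∀ R > 0, ∃ K > 0, ∀ z ∈ strip R, ∀ w ∈ strip R, ‖C z - C w‖ ≤ K * ‖z - w‖

/-- Real points go to real points, so the imaginary part of `C z` is at most the Lipschitz constant
times the distance from `z` to its real part. -/
theorem IsLift.mapsTo {F : Torus → Torus} {C : ℂ × ℂ → ℂ × ℂ} (h : IsLift F C) {R : ℝ}
    (hR : 0 < R) : ∃ R' > 0, ∀ z ∈ strip R, C z ∈ strip R' := by
  obtain ⟨K, hK, hl⟩ := h.lipschitz R hR
  refine ⟨K * R, by positivity, fun z hz => ?_⟩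
  obtain ⟨y, hy, -⟩ := h.real (z.1.re, z.2.re)
  have h1 := hl z hz _ (toC_mem_strip hR (z.1.re, z.2.re))
  have h2 : ‖z - toC (z.1.re, z.2.re)‖ < R := by
    have e1 : z.1 - (z.1.re : ℂ) = z.1.im * Complex.I := by
      apply Complex.ext <;> simp
    have e2 : z.2 - (z.2.re : ℂ) = z.2.im * Complex.I := by
      apply Complex.ext <;> simp
    rw [Prod.norm_def]
    simp only [Prod.fst_sub, Prod.snd_sub, toC, e1, e2, norm_mul, Complex.norm_real,
      Complex.norm_I, mul_one, Real.norm_eq_abs]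
    exact max_lt hz.1 hz.2
  rw [hy] at h1
  have h3 : ‖C z - toC y‖ < K * R := h1.trans_lt (by gcongr)
  rw [Prod.norm_def, max_lt_iff] at h3
  constructor
  · have := Complex.abs_im_le_norm (C z - toC y).1
    simp only [Prod.fst_sub, toC, Complex.sub_im, Complex.ofReal_im, sub_zero] at this h3
    exact this.trans_lt h3.1
  · have := Complex.abs_im_le_norm (C z - toC y).2
    simp only [Prod.snd_sub, toC, Complex.sub_im, Complex.ofReal_im, sub_zero] at this h3
    exact this.trans_lt h3.2

theorem IsLift.comp {F G : Torus → Torus} {C D : ℂ × ℂ → ℂ × ℂ} (hF : IsLift F C)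
    (hG : IsLift G D) : IsLift (F ∘ G) (C ∘ D) where
  differentiable := hF.differentiable.comp hG.differentiable
  real x := by
    obtain ⟨y, hy, hy'⟩ := hG.real x
    obtain ⟨w, hw, hw'⟩ := hF.real y
    exact ⟨w, by simp [hy, hw], by simp [hw', hy']⟩
  equivariant := by
    obtain ⟨A, hA⟩ := hF.equivariant
    obtain ⟨B, hB⟩ := hG.equivariant
    exact ⟨A ∘ B, fun z v => by simp [hA, hB]⟩
  lipschitz R hR := by
    obtain ⟨R', hR', hm⟩ := hG.mapsTo hR
    obtain ⟨K, hK, hl⟩ := hG.lipschitz R hR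
    obtain ⟨L, hL, hl'⟩ := hF.lipschitz R' hR'
    refine ⟨L * K, by positivity, fun z hz w hw => ?_⟩
    calc _ ≤ L * ‖D z - D w‖ := hl' _ (hm z hz) _ (hm w hw)
      _ ≤ L * (K * ‖z - w‖) := by gcongr; exact hl z hz w hw
      _ = _ := by ring

theorem isLift_id : IsLift id id where
  differentiable := differentiable_id
  real x := ⟨x, rfl, rfl⟩
  equivariant := ⟨id, fun _ _ => rfl⟩
  lipschitz R _ := ⟨1, one_pos, fun z _ w _ => by simp⟩

/-- The complexification of `rot`. -/
def rotC (t : ℝ) : Equiv.Perm (ℂ × ℂ) where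
  toFun z := (z.1 + t, z.2)
  invFun z := (z.1 - t, z.2)
  left_inv z := by simp
  right_inv z := by simp

/-- The complexification of `phi`. -/
noncomputable def phiC (q : ℕ) : Equiv.Perm (ℂ × ℂ) where
  toFun z := (z.1, z.2 + (q : ℂ) ^ 2 * Complex.cos (2 * Real.pi * q * z.1))
  invFun z := (z.1, z.2 - (q : ℂ) ^ 2 * Complex.cos (2 * Real.pi * q * z.1))
  left_inv z := by simp
  right_inv z := by simp

/-- The complexification of `shear`. -/
def shearC (b : ℤ) : Equiv.Perm (ℂ × ℂ) where
  toFun z := (z.1 + b * z.2, z.2)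
  invFun z := (z.1 - b * z.2, z.2)
  left_inv z := by simp
  right_inv z := by simp

theorem isLift_rot (t : ℝ) : IsLift (rot t) (rotC t) where
  differentiable := by
    simp only [rotC, Equiv.coe_fn_mk]
    fun_prop
  real x := ⟨(x.1 + t, x.2), by simp [rotC, toC], by simp [rot, proj]⟩
  equivariant := ⟨id, fun z v => by
    simp only [rotC, intC, Equiv.coe_fn_mk, Prod.fst_add, Prod.snd_add, id, Prod.mk_add_mk]
    ring_nf⟩
  lipschitz R _ := ⟨1, one_pos, fun z _ w _ => by simp [rotC, Prod.norm_def]⟩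

/-- Mean value inequality on the convex strip `|Im z| ≤ R`, where `|sin z| ≤ exp R`. -/
theorem norm_cos_sub_cos_le {R : ℝ} {a b : ℂ} (ha : |a.im| ≤ R) (hb : |b.im| ≤ R) :
    ‖Complex.cos a - Complex.cos b‖ ≤ Real.exp R * ‖a - b‖ := by
  have hconv : Convex ℝ {z : ℂ | |z.im| ≤ R} := by
    have : {z : ℂ | |z.im| ≤ R} = Complex.imCLM ⁻¹' (Set.Icc (-R) R) := by
      ext z
      simp [abs_le]
    rw [this]
    exact (convex_Icc _ _).linear_preimage Complex.imCLM.toLinearMap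
  refine hconv.norm_image_sub_le_of_norm_hasDerivWithin_le
    (f' := fun z => -Complex.sin z)
    (fun z _ => (Complex.hasDerivAt_cos z).hasDerivWithinAt) (fun z hz => ?_) hb ha
  rw [norm_neg, Complex.sin, norm_div, norm_mul, Complex.norm_I, mul_one, Complex.norm_ofNat]
  have h1 : ‖Complex.exp (-z * Complex.I)‖ ≤ Real.exp R := by
    rw [Complex.norm_exp]
    apply Real.exp_le_exp.2
    simpa using (le_abs_self _).trans hz
  have h2 : ‖Complex.exp (z * Complex.I)‖ ≤ Real.exp R := by
    rw [Complex.norm_exp]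
    apply Real.exp_le_exp.2
    simpa using (neg_le_abs _).trans hz
  rw [div_le_iff₀ (by norm_num)]
  calc _ ≤ _ := norm_sub_le _ _
    _ ≤ _ := by linarith

theorem circleCos_coe (q : ℕ) (x : ℝ) :
    circleCos q (x : UnitAddCircle) = Real.cos (2 * Real.pi * q * x) := rfl

theorem isLift_phi_aux (q : ℕ) (c : ℝ) :
    IsLift (fun x => (x.1, x.2 + ((c * circleCos q x.1 : ℝ) : UnitAddCircle)))
      (fun z => (z.1, z.2 + c * Complex.cos (2 * Real.pi * q * z.1))) where
  differentiable := by fun_prop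
  real x := ⟨(x.1, x.2 + c * Real.cos (2 * Real.pi * q * x.1)), by simp [toC],
    by simp [proj, circleCos_coe]⟩
  equivariant := ⟨id, fun z v => by
    have h : 2 * (Real.pi : ℂ) * q * (z.1 + v.1) =
        2 * Real.pi * q * z.1 + ((q * v.1 : ℤ) : ℂ) * (2 * Real.pi) := by
      push_cast
      ring
    simp only [intC, Prod.fst_add, Prod.snd_add, id, Prod.mk_add_mk, h,
      Complex.cos_add_int_mul_two_pi]
    ring_nf⟩
  lipschitz R hR := by
    refine ⟨1 + |c| * (Real.exp (2 * Real.pi * q * R) * (2 * Real.pi * q)), by positivity,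
      fun z hz w hw => ?_⟩
    have him : ∀ u : ℂ, |u.im| < R → |(2 * Real.pi * q * u : ℂ).im| ≤ 2 * Real.pi * q * R := by
      intro u hu
      have : (2 * Real.pi * q * u : ℂ).im = 2 * Real.pi * q * u.im := by
        have : (2 * Real.pi * q * u : ℂ) = ((2 * Real.pi * q : ℝ) : ℂ) * u := by push_cast; ring
        rw [this, Complex.im_ofReal_mul]
      rw [this, abs_mul, abs_of_nonneg (by positivity)]
      gcongr
    have hcos := norm_cos_sub_cos_le (him _ hz.1) (him _ hw.1)
    have hn : ‖(2 * Real.pi * q * z.1 : ℂ) - 2 * Real.pi * q * w.1‖ =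
        2 * Real.pi * q * ‖z.1 - w.1‖ := by
      rw [← mul_sub, norm_mul]
      congr 1
      have : (2 * Real.pi * q : ℂ) = ((2 * Real.pi * q : ℝ) : ℂ) := by push_cast; ring
      rw [this, Complex.norm_real, Real.norm_of_nonneg (by positivity)]
    rw [hn] at hcos
    have h1 : ‖z.1 - w.1‖ ≤ ‖z - w‖ := norm_fst_le (z - w)
    have h2 : ‖z.2 - w.2‖ ≤ ‖z - w‖ := norm_snd_le (z - w)
    have hp : (0 : ℝ) ≤ |c| * (Real.exp (2 * Real.pi * q * R) * (2 * Real.pi * q)) := by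
      positivity
    rw [Prod.norm_def]
    apply max_le
    · simp only [Prod.fst_sub]
      nlinarith [norm_nonneg (z - w)]
    · simp only [Prod.snd_sub]
      calc _ = ‖(z.2 - w.2) + c * (Complex.cos (2 * Real.pi * q * z.1) -
              Complex.cos (2 * Real.pi * q * w.1))‖ := by congr 1; ring
        _ ≤ ‖z.2 - w.2‖ + |c| * ‖Complex.cos (2 * Real.pi * q * z.1) -
              Complex.cos (2 * Real.pi * q * w.1)‖ := by
            refine (norm_add_le _ _).trans ?_
            rw [norm_mul, Complex.norm_real, Real.norm_eq_abs]
        _ ≤ ‖z - w‖ + |c| * (Real.exp (2 * Real.pi * q * R) *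
              (2 * Real.pi * q * ‖z - w‖)) := by
            gcongr
            exact hcos.trans (by gcongr)
        _ = _ := by ring

theorem isLift_phi (q : ℕ) : IsLift (phi q) (phiC q) := by
  convert isLift_phi_aux q ((q : ℝ) ^ 2) using 1
  · ext1 z
    simp [phi]
  · ext1 z
    simp [phiC]

theorem isLift_phi_symm (q : ℕ) : IsLift (phi q).symm (phiC q).symm := by
  convert isLift_phi_aux q (-(q : ℝ) ^ 2) using 1
  · ext1 z
    simp [phi, sub_eq_add_neg]
  · ext1 z
    simp [phiC, sub_eq_add_neg]

theorem isLift_shear (b : ℤ) : IsLift (shear b) (shearC b) where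
  differentiable := by
    simp only [shearC, Equiv.coe_fn_mk]
    fun_prop
  real x := ⟨(x.1 + b * x.2, x.2), by simp [shearC, toC], by simp [shear, proj, ← zsmul_eq_mul]⟩
  equivariant := ⟨fun v => (v.1 + b * v.2, v.2), fun z v => by
    simp only [shearC, intC, Equiv.coe_fn_mk, Prod.fst_add, Prod.snd_add, Prod.mk_add_mk]
    push_cast
    ring_nf⟩
  lipschitz R hR := by
    refine ⟨1 + |(b : ℝ)|, by positivity, fun z _ w _ => ?_⟩
    have h1 : ‖z.1 - w.1‖ ≤ ‖z - w‖ := norm_fst_le (z - w)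
    have h2 : ‖z.2 - w.2‖ ≤ ‖z - w‖ := norm_snd_le (z - w)
    rw [Prod.norm_def]
    apply max_le
    · calc _ = ‖(z.1 - w.1) + b * (z.2 - w.2)‖ := by
            simp only [shearC, Equiv.coe_fn_mk, Prod.fst_sub]; congr 1; ring
        _ ≤ ‖z.1 - w.1‖ + |(b : ℝ)| * ‖z.2 - w.2‖ := by
            refine (norm_add_le _ _).trans ?_
            rw [norm_mul, Complex.norm_intCast]
        _ ≤ ‖z - w‖ + |(b : ℝ)| * ‖z - w‖ := by gcongr
        _ = _ := by ring
    · refine h2.trans ?_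
      nlinarith [norm_nonneg (z - w), abs_nonneg (b : ℝ)]

theorem isLift_shear_symm (b : ℤ) : IsLift (shear b).symm (shearC b).symm := by
  convert isLift_shear (-b) using 1
  · ext1 z
    simp [shear, sub_eq_add_neg]
  · ext1 z
    simp [shearC, sub_eq_add_neg]

/-- The complexification of `hMap`. -/
noncomputable def hMapC (σ : ℝ) (q : ℕ → ℕ) (n : ℕ) : Equiv.Perm (ℂ × ℂ) :=
  shearC ⌊(n : ℝ) * (q n : ℝ) ^ σ⌋ * phiC (q n)

/-- The complexification of `HMap`. -/
noncomputable def HMapC (σ : ℝ) (q : ℕ → ℕ) : ℕ → Equiv.Perm (ℂ × ℂ)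
  | 0 => 1
  | n + 1 => HMapC σ q n * hMapC σ q (n + 1)

theorem isLift_HMap (σ : ℝ) (q : ℕ → ℕ) (n : ℕ) :
    IsLift (HMap σ q n) (HMapC σ q n) ∧ IsLift (HMap σ q n).symm (HMapC σ q n).symm := by
  induction n with
  | zero => exact ⟨isLift_id, isLift_id⟩
  | succ n ih =>
    constructor
    · exact ih.1.comp ((isLift_shear _).comp (isLift_phi _))
    · exact ((isLift_phi_symm _).comp (isLift_shear_symm _)).comp ih.2

theorem isLift_conj {H : Equiv.Perm Torus} {C : Equiv.Perm (ℂ × ℂ)} (h : IsLift H C)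
    (h' : IsLift H.symm C.symm) (t : ℝ) :
    IsLift (H * rot t * H⁻¹ : Equiv.Perm Torus) (C * rotC t * C⁻¹ : Equiv.Perm (ℂ × ℂ)) :=
  (h.comp (isLift_rot t)).comp h'

/-- The lift `C` may act nontrivially on `ℤ²` (shears do), but rotations commute with `ℤ²` and the
actions of `C⁻¹` and `C` cancel. This is what makes the conjugates homotopic to the identity. -/
theorem conj_add_intC {H : Equiv.Perm Torus} {C : Equiv.Perm (ℂ × ℂ)} (h : IsLift H C)
    (h' : IsLift H.symm C.symm) (t : ℝ) (z : ℂ × ℂ) (v : ℤ × ℤ) :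
    (C * rotC t * C⁻¹ : Equiv.Perm (ℂ × ℂ)) (z + intC v) =
      (C * rotC t * C⁻¹ : Equiv.Perm (ℂ × ℂ)) z + intC v := by
  obtain ⟨A, hA⟩ := h.equivariant
  obtain ⟨B, hB⟩ := h'.equivariant
  have hAB : intC (A (B v)) = intC v := by
    have h1 := hA (C.symm z) (B v)
    rw [← hB, C.apply_symm_apply, C.apply_symm_apply] at h1
    exact (add_left_cancel h1).symm
  have hr : ∀ w u, rotC t (w + intC u) = rotC t w + intC u := by
    intro w u
    simp only [rotC, intC, Equiv.coe_fn_mk, Prod.fst_add, Prod.snd_add, Prod.mk_add_mk]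
    ring_nf
  have hB' : C⁻¹ (z + intC v) = C⁻¹ z + intC (B v) := hB z v
  simp only [Equiv.Perm.mul_apply, hB', hr, hA, hAB]

/-! ### The perturbation estimate -/

theorem conj_rotC_apply (b : ℤ) (q : ℕ) (t : ℝ) (y : ℂ × ℂ) :
    ((shearC b * phiC q) * rotC t * (shearC b * phiC q)⁻¹ : Equiv.Perm (ℂ × ℂ)) y =
      (y.1 + t + b * ((q : ℂ) ^ 2 * (Complex.cos (2 * Real.pi * q * (y.1 - b * y.2 + t)) -
          Complex.cos (2 * Real.pi * q * (y.1 - b * y.2)))),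
        y.2 + (q : ℂ) ^ 2 * (Complex.cos (2 * Real.pi * q * (y.1 - b * y.2 + t)) -
          Complex.cos (2 * Real.pi * q * (y.1 - b * y.2)))) := by
  have e : (shearC b * phiC q)⁻¹ y = (y.1 - b * y.2,
      y.2 - (q : ℂ) ^ 2 * Complex.cos (2 * Real.pi * q * (y.1 - b * y.2))) := rfl
  rw [Equiv.Perm.mul_apply, e]
  simp only [Equiv.Perm.mul_apply, shearC, phiC, rotC, Equiv.coe_fn_mk]
  ext1 <;> simp only <;> ring

/-- Since `m p / q` is a multiple of `1/q`, the cosine does not see it, and only the error `e = m (x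
- p/q)` remains. The argument `y.1 - b y.2` has imaginary part at most `(1 + β) R`, whence the
exponential factor. -/
theorem norm_conj_rotC_sub_le {R β : ℝ} (b : ℤ) (hb : |(b : ℝ)| ≤ β) {q : ℕ}
    (hq : 0 < q) (p m : ℤ) (x : ℝ) {y : ℂ × ℂ} (hy : y ∈ strip R) :
    ‖((shearC b * phiC q) * rotC (m * x) * (shearC b * phiC q)⁻¹ : Equiv.Perm (ℂ × ℂ)) y -
        rotC (m * ((p : ℝ) / q)) y‖ ≤
      |m * (x - (p : ℝ) / q)| * (1 + (1 + β) * (2 * Real.pi * q ^ 3 *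
        Real.exp (2 * Real.pi * q * ((1 + β) * R)))) := by
  rw [conj_rotC_apply]
  set e : ℝ := m * (x - (p : ℝ) / q) with he
  set s : ℂ := y.1 - b * y.2 with hs
  have hq' : (q : ℂ) ≠ 0 := by exact_mod_cast hq.ne'
  have hR : 0 ≤ R := (abs_nonneg _).trans hy.1.le
  have hβ : 0 ≤ β := (abs_nonneg _).trans hb
  have h1 : Complex.cos (2 * Real.pi * q * (s + ((m * x : ℝ) : ℂ))) =
      Complex.cos (2 * Real.pi * q * (s + e)) := by
    have : (2 * Real.pi * q * (s + ((m * x : ℝ) : ℂ)) : ℂ) =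
        2 * Real.pi * q * (s + e) + ((m * p : ℤ) : ℂ) * (2 * Real.pi) := by
      rw [he]
      push_cast
      field_simp
      ring
    rw [this, Complex.cos_add_int_mul_two_pi]
  have hsim : |s.im| ≤ (1 + β) * R := by
    have : s.im = y.1.im - b * y.2.im := by
      simp [hs]
    rw [this]
    calc |y.1.im - b * y.2.im| ≤ |y.1.im| + |b * y.2.im| := abs_sub _ _
      _ = |y.1.im| + |(b : ℝ)| * |y.2.im| := by rw [abs_mul]
      _ ≤ R + β * R := by
        gcongr
        · exact hy.1.le
        · exact hy.2.le
      _ = _ := by ring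
  have him : ∀ u : ℂ, |u.im| ≤ (1 + β) * R →
      |(2 * Real.pi * q * u : ℂ).im| ≤ 2 * Real.pi * q * ((1 + β) * R) := by
    intro u hu
    have : (2 * Real.pi * q * u : ℂ).im = 2 * Real.pi * q * u.im := by
      have : (2 * Real.pi * q * u : ℂ) = ((2 * Real.pi * q : ℝ) : ℂ) * u := by push_cast; ring
      rw [this, Complex.im_ofReal_mul]
    rw [this, abs_mul, abs_of_nonneg (by positivity)]
    gcongr
  have hcos := norm_cos_sub_cos_le (him (s + e) (by simpa using hsim)) (him s hsim)
  have hn : ‖(2 * Real.pi * q * (s + e) : ℂ) - 2 * Real.pi * q * s‖ =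
      2 * Real.pi * q * |e| := by
    have : (2 * Real.pi * q * (s + e) : ℂ) - 2 * Real.pi * q * s =
      ((2 * Real.pi * q * e : ℝ) : ℂ) := by push_cast; ring
    rw [this, Complex.norm_real, Real.norm_eq_abs, abs_mul, abs_of_nonneg (a := 2 * Real.pi * q)
      (by positivity)]
  rw [hn] at hcos
  rw [h1]
  set Δ : ℂ := (q : ℂ) ^ 2 * (Complex.cos (2 * Real.pi * q * (s + e)) -
    Complex.cos (2 * Real.pi * q * s)) with hΔ
  have hΔn : ‖Δ‖ ≤ |e| * (2 * Real.pi * q ^ 3 *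
      Real.exp (2 * Real.pi * q * ((1 + β) * R))) := by
    rw [hΔ, norm_mul, norm_pow, Complex.norm_natCast]
    calc _ ≤ (q : ℝ) ^ 2 * (Real.exp (2 * Real.pi * q * ((1 + β) * R)) *
          (2 * Real.pi * q * |e|)) := by gcongr
      _ = _ := by ring
  have e0 : 0 ≤ |e| := abs_nonneg e
  rw [Prod.norm_def]
  apply max_le
  · have : (y.1 + ((m * x : ℝ) : ℂ) + b * Δ, y.2 + Δ).1 - (rotC (m * ((p : ℝ) / q)) y).1 =
        e + b * Δ := by
      simp only [rotC, Equiv.coe_fn_mk, he]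
      push_cast
      ring
    rw [Prod.fst_sub, this]
    calc ‖(e : ℂ) + b * Δ‖ ≤ |e| + |(b : ℝ)| * ‖Δ‖ := by
          refine (norm_add_le _ _).trans (le_of_eq ?_)
          rw [norm_mul, Complex.norm_real, Complex.norm_intCast, Real.norm_eq_abs]
      _ ≤ |e| + (1 + β) * ‖Δ‖ := by
          gcongr
          linarith
      _ ≤ |e| + (1 + β) * (|e| * (2 * Real.pi * q ^ 3 *
            Real.exp (2 * Real.pi * q * ((1 + β) * R)))) := by gcongr
      _ = _ := by ring
  · have : (y.1 + ((m * x : ℝ) : ℂ) + b * Δ, y.2 + Δ).2 - (rotC (m * ((p : ℝ) / q)) y).2 =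
        Δ := by
      simp [rotC]
    rw [Prod.snd_sub, this]
    calc ‖Δ‖ ≤ 0 + 1 * ‖Δ‖ := by linarith
      _ ≤ |e| + (1 + β) * ‖Δ‖ := by
          gcongr
          linarith
      _ ≤ |e| + (1 + β) * (|e| * (2 * Real.pi * q ^ 3 *
            Real.exp (2 * Real.pi * q * ((1 + β) * R)))) := by gcongr
      _ = _ := by ring

/-- The growth exponent is `O(x^(1+σ))`, while `x^(1+δ)` is `x^(1+σ)` times the unbounded factor
`x^(δ-σ)`. So the decay wins with a spare `exp(-x)`, which absorbs the polynomial factors. -/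
theorem tendsto_perturbation_bound {σ δ R : ℝ} (hσ : 0 < σ) (hσδ : σ < δ) (hσ1 : σ ≤ 1)
    (hR : 0 ≤ R) (n : ℕ) :
    Tendsto (fun x : ℝ => x * (2 * Real.exp (-x ^ (1 + δ))) * (1 + (1 + n * x ^ σ) *
      (2 * Real.pi * x ^ 3 * Real.exp (2 * Real.pi * x * ((1 + n * x ^ σ) * R)))))
      atTop (𝓝 0) := by
  have hlim : Tendsto (fun x : ℝ => 2 * (x ^ 1 * Real.exp (-x)) +
      (4 * Real.pi * (n + 1)) * (x ^ 5 * Real.exp (-x))) atTop (𝓝 0) := by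
    have h := ((Real.tendsto_pow_mul_exp_neg_atTop_nhds_zero 1).const_mul 2).add
      ((Real.tendsto_pow_mul_exp_neg_atTop_nhds_zero 5).const_mul (4 * Real.pi * (n + 1)))
    simpa using h
  have hC : ∀ᶠ x : ℝ in atTop, 2 * Real.pi * (n + 1) * R + 1 ≤ x ^ (δ - σ) :=
    (tendsto_rpow_atTop (by linarith)).eventually_ge_atTop _
  refine tendsto_of_tendsto_of_tendsto_of_le_of_le' tendsto_const_nhds hlim ?_ ?_
  · filter_upwards [eventually_ge_atTop 0] with x hx
    positivity
  · filter_upwards [hC, eventually_ge_atTop 1] with x hx hx1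
    have hx0 : 0 < x := by linarith
    have hσx : 1 ≤ x ^ σ := Real.one_le_rpow hx1 hσ.le
    have hσx' : x ^ σ ≤ x := by
      simpa using Real.rpow_le_rpow_of_exponent_le hx1 hσ1
    have hb : 1 + n * x ^ σ ≤ (n + 1) * x ^ σ := by linarith
    have hpow : x ^ (1 + δ) = x * x ^ σ * x ^ (δ - σ) := by
      rw [mul_assoc, ← Real.rpow_add hx0, Real.rpow_add hx0, Real.rpow_one]
      ring_nf
    have hexp : 2 * Real.pi * x * ((1 + n * x ^ σ) * R) + x ≤ x ^ (1 + δ) := by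
      have h1 : 2 * Real.pi * x * ((1 + n * x ^ σ) * R) ≤
          x * x ^ σ * (2 * Real.pi * (n + 1) * R) := by
        calc _ ≤ 2 * Real.pi * x * (((n + 1) * x ^ σ) * R) := by gcongr
          _ = _ := by ring
      have h2 : x ≤ x * x ^ σ := le_mul_of_one_le_right hx0.le hσx
      have h3 : x * x ^ σ * (2 * Real.pi * (n + 1) * R + 1) ≤ x * x ^ σ * x ^ (δ - σ) := by
        gcongr
      rw [hpow]
      linarith
    set E := Real.exp (2 * Real.pi * x * ((1 + n * x ^ σ) * R)) with hE
    have hE1 : Real.exp (-x ^ (1 + δ)) * E ≤ Real.exp (-x) := by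
      rw [hE, ← Real.exp_add]
      apply Real.exp_le_exp.2
      linarith
    have hE0 : Real.exp (-x ^ (1 + δ)) ≤ Real.exp (-x) := by
      refine le_trans ?_ hE1
      apply le_mul_of_one_le_right (Real.exp_pos _).le
      rw [hE]
      exact Real.one_le_exp (by positivity)
    calc _ = 2 * x * Real.exp (-x ^ (1 + δ)) + 4 * Real.pi * (1 + n * x ^ σ) * x ^ 4 *
          (Real.exp (-x ^ (1 + δ)) * E) := by ring
      _ ≤ 2 * x * Real.exp (-x) + 4 * Real.pi * ((n + 1) * x) * x ^ 4 * Real.exp (-x) := by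
          gcongr
          exact hb.trans (by gcongr)
      _ = _ := by ring

/-- Passing from `H R_{m p / q} H⁻¹` to `(H h) R_{m x} (H h)⁻¹` costs little on a given strip
once `q` is large, provided `x` is close to `p / q`. -/
theorem eventually_perturbation {σ δ ρ : ℝ} (hσ : 0 < σ) (hσδ : σ < δ) (hσ1 : σ ≤ 1) (hρ : 0 < ρ)
    {H : Torus → Torus} {H' : Torus → Torus} {C : Equiv.Perm (ℂ × ℂ)} (h : IsLift H C)
    (h' : IsLift H' C.symm) (n : ℕ) {ε : ℝ} (hε : 0 < ε) :
    ∀ᶠ q : ℕ in atTop, ∀ (p : ℤ) (x : ℝ),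
      |x - (p : ℝ) / q| ≤ 2 * Real.exp (-(q : ℝ) ^ (1 + δ)) → ∀ m : ℤ, |m| ≤ q →
        ∀ z ∈ strip ρ,
          ‖((C * (shearC ⌊(n : ℝ) * (q : ℝ) ^ σ⌋ * phiC q)) * rotC (m * x) *
              (C * (shearC ⌊(n : ℝ) * (q : ℝ) ^ σ⌋ * phiC q))⁻¹ : Equiv.Perm (ℂ × ℂ)) z -
            (C * rotC (m * ((p : ℝ) / q)) * C⁻¹ : Equiv.Perm (ℂ × ℂ)) z‖ ≤ ε := by
  obtain ⟨R, hR, hm⟩ := h'.mapsTo hρ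
  obtain ⟨K, hK, hl⟩ := h.lipschitz (R + 1) (by linarith)
  have hlim := (tendsto_perturbation_bound hσ hσδ hσ1 hR.le n).comp tendsto_natCast_atTop_atTop
  -- The bound `1` keeps the perturbed point in the strip of width `R + 1`, where `C` is
  -- `K`-Lipschitz; the bound `ε / K` then gives `ε` after applying `C`.
  have hev := hlim.eventually (gt_mem_nhds (show (0 : ℝ) < min 1 (ε / K) by positivity))
  filter_upwards [hev, eventually_gt_atTop 0] with q hq hq0 p x hx m hmq z hz
  set b := ⌊(n : ℝ) * (q : ℝ) ^ σ⌋ with hb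
  have hb0 : 0 ≤ b := Int.floor_nonneg.2 (by positivity)
  have hbβ : |(b : ℝ)| ≤ n * (q : ℝ) ^ σ := by
    rw [abs_of_nonneg (by exact_mod_cast hb0)]
    exact Int.floor_le _
  have hy := hm z hz
  set y := C.symm z with hy_def
  have key := norm_conj_rotC_sub_le b hbβ hq0 p m x hy
  have hm' : |m * (x - (p : ℝ) / q)| ≤ q * (2 * Real.exp (-(q : ℝ) ^ (1 + δ))) := by
    rw [abs_mul]
    gcongr
    exact_mod_cast hmq
  have key2 := key.trans (mul_le_mul_of_nonneg_right hm' (by positivity))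
  have key3 := key2.trans_lt hq
  rw [lt_min_iff] at key3
  have e1 : ((C * (shearC b * phiC q)) * rotC (m * x) * (C * (shearC b * phiC q))⁻¹ :
      Equiv.Perm (ℂ × ℂ)) z =
      C (((shearC b * phiC q) * rotC (m * x) * (shearC b * phiC q)⁻¹ : Equiv.Perm (ℂ × ℂ)) y) :=
    rfl
  have e2 : (C * rotC (m * ((p : ℝ) / q)) * C⁻¹ : Equiv.Perm (ℂ × ℂ)) z =
      C (rotC (m * ((p : ℝ) / q)) y) := rfl
  rw [e1, e2]
  set u := ((shearC b * phiC q) * rotC (m * x) * (shearC b * phiC q)⁻¹ : Equiv.Perm (ℂ × ℂ)) y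
  have hw : rotC (m * ((p : ℝ) / q)) y ∈ strip R := by
    have : (((m : ℝ) * ((p : ℝ) / q) : ℝ) : ℂ).im = 0 := Complex.ofReal_im _
    simpa only [rotC, Equiv.coe_fn_mk, strip, Set.mem_ofPred_eq, Complex.add_im, this,
      add_zero] using hy
  set w := rotC (m * ((p : ℝ) / q)) y
  have hw' : w ∈ strip (R + 1) := ⟨hw.1.trans (by linarith), hw.2.trans (by linarith)⟩
  have hu : u ∈ strip (R + 1) := by
    have i1 : ‖u.1 - w.1‖ < 1 := (norm_fst_le (u - w)).trans_lt key3.1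
    have i2 : ‖u.2 - w.2‖ < 1 := (norm_snd_le (u - w)).trans_lt key3.1
    have j1 := (Complex.abs_im_le_norm (u.1 - w.1)).trans_lt i1
    have j2 := (Complex.abs_im_le_norm (u.2 - w.2)).trans_lt i2
    rw [Complex.sub_im] at j1 j2
    constructor
    · have := abs_add_le (u.1.im - w.1.im) w.1.im
      rw [sub_add_cancel] at this
      linarith [hw.1]
    · have := abs_add_le (u.2.im - w.2.im) w.2.im
      rw [sub_add_cancel] at this
      linarith [hw.2]
  calc _ ≤ K * ‖u - w‖ := hl u hu w hw'
    _ ≤ K * (ε / K) := by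
        gcongr
        exact key3.2.le
    _ = ε := by field_simp

/-! ### The oscillatory integral -/

open FourierTransform in
-- The substitution `y = cos(2πs)` turns the integral into the Fourier transform of the arcsine
-- density restricted to the image of `S`, and Riemann–Lebesgue applies.
theorem tendsto_setIntegral_fourierChar_cos {S : Set ℝ} (hS : MeasurableSet S)
    (hinj : Set.InjOn (fun s : ℝ => Real.cos (2 * Real.pi * s)) S)
    (hsin : ∀ s ∈ S, Real.sin (2 * Real.pi * s) ≠ 0) :
    Tendsto (fun a : ℝ => ∫ s in S, (𝐞 (-(Real.cos (2 * Real.pi * s) * a)) : ℂ))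
      (cocompact ℝ) (𝓝 0) := by
  set f : ℝ → ℝ := fun s => Real.cos (2 * Real.pi * s) with hf
  have hd : ∀ s ∈ S, HasDerivWithinAt f (-Real.sin (2 * Real.pi * s) * (2 * Real.pi)) S s := by
    intro s _
    have h1 : HasDerivAt (fun s : ℝ => 2 * Real.pi * s) (2 * Real.pi) s := by
      simpa using (hasDerivAt_id s).const_mul (2 * Real.pi)
    exact h1.cos.hasDerivWithinAt
  have hw : ∀ s ∈ S, |-Real.sin (2 * Real.pi * s) * (2 * Real.pi)| *
      (2 * Real.pi * Real.sqrt (1 - f s ^ 2))⁻¹ = 1 := by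
    intro s hs
    have h1 : 1 - f s ^ 2 = Real.sin (2 * Real.pi * s) ^ 2 := by
      have := Real.sin_sq_add_cos_sq (2 * Real.pi * s)
      simp only [hf]
      linarith
    rw [h1, Real.sqrt_sq_eq_abs, abs_mul, abs_neg, abs_of_pos Real.two_pi_pos, mul_comm |_|]
    apply mul_inv_cancel₀
    have := hsin s hs
    have := Real.pi_pos
    positivity
  have him : MeasurableSet (f '' S) :=
    hS.image_of_continuousOn_injOn (by fun_prop) hinj
  set g : ℝ → ℂ := (f '' S).indicator
    (fun y => (((2 * Real.pi * Real.sqrt (1 - y ^ 2))⁻¹ : ℝ) : ℂ)) with hg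
  refine (Real.tendsto_integral_exp_smul_cocompact g).congr fun a => ?_
  have e1 : (fun v : ℝ => 𝐞 (-(v * a)) • g v) = (f '' S).indicator
      (fun y => 𝐞 (-(y * a)) • (((2 * Real.pi * Real.sqrt (1 - y ^ 2))⁻¹ : ℝ) : ℂ)) := by
    ext1 v
    by_cases hv : v ∈ f '' S <;> simp [hg, hv]
  rw [e1, integral_indicator him, integral_image_eq_integral_abs_deriv_smul hS hd hinj]
  apply setIntegral_congr_fun hS
  intro s hs
  have := congrArg (fun x : ℝ => (x : ℂ)) (hw s hs)
  simp only [Complex.ofReal_mul, Complex.ofReal_one] at this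
  simp only [Circle.smul_def, Complex.real_smul, smul_eq_mul]
  rw [mul_left_comm, this, mul_one]

open FourierTransform in
theorem tendsto_integral_fourierChar_circleCos :
    Tendsto (fun a : ℝ => ∫ s : UnitAddCircle, (𝐞 (-(circleCos 1 s * a)) : ℂ))
      (cocompact ℝ) (𝓝 0) := by
  have hpi := Real.pi_pos
  have h1 := tendsto_setIntegral_fourierChar_cos (S := Set.Ioo 0 (1 / 2)) measurableSet_Ioo (by
      intro x hx y hy hxy
      have := Real.injOn_cos (x₁ := 2 * Real.pi * x) (x₂ := 2 * Real.pi * y)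
        ⟨by have := hx.1; positivity, by nlinarith [hx.2]⟩
        ⟨by have := hy.1; positivity, by nlinarith [hy.2]⟩ hxy
      exact mul_left_cancel₀ Real.two_pi_pos.ne' this) (by
      intro s hs
      exact (Real.sin_pos_of_pos_of_lt_pi (by have := hs.1; positivity)
        (by nlinarith [hs.2])).ne')
  -- The reflection `s ↦ 1 - s` reduces this half of the period to the first one.
  have h2 := tendsto_setIntegral_fourierChar_cos (S := Set.Ioo (1 / 2) 1) measurableSet_Ioo (by
      intro x hx y hy hxy
      have hxy' : Real.cos (2 * Real.pi * (1 - x)) = Real.cos (2 * Real.pi * (1 - y)) := by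
        simpa [mul_sub, Real.cos_two_pi_sub] using hxy
      have := Real.injOn_cos (x₁ := 2 * Real.pi * (1 - x)) (x₂ := 2 * Real.pi * (1 - y))
        ⟨by have := sub_pos.2 hx.2; positivity, by nlinarith [hx.1]⟩
        ⟨by have := sub_pos.2 hy.2; positivity, by nlinarith [hy.1]⟩ hxy'
      linarith [mul_left_cancel₀ Real.two_pi_pos.ne' this]) (by
      intro s hs
      have h := Real.sin_pos_of_pos_of_lt_pi (x := 2 * Real.pi * (1 - s))
        (by have := sub_pos.2 hs.2; positivity) (by nlinarith [hs.1])
      rw [mul_sub, mul_one, Real.sin_two_pi_sub] at h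
      linarith)
  have h12 := h1.add h2
  rw [add_zero] at h12
  refine h12.congr fun a => ?_
  rw [← UnitAddCircle.intervalIntegral_preimage 0]
  have hc : Continuous fun s : ℝ => (𝐞 (-(Real.cos (2 * Real.pi * s) * a)) : ℂ) := by
    fun_prop
  have e : ∀ s : ℝ, circleCos 1 (s : UnitAddCircle) = Real.cos (2 * Real.pi * s) := by
    intro s
    rw [circleCos_coe]
    simp
  simp only [e, zero_add]
  rw [← intervalIntegral.integral_add_adjacent_intervals (b := 1 / 2)
    (hc.intervalIntegrable _ _) (hc.intervalIntegrable _ _),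
    intervalIntegral.integral_of_le (by norm_num), intervalIntegral.integral_of_le (by norm_num),
    integral_Ioc_eq_integral_Ioo, integral_Ioc_eq_integral_Ioo]

theorem circleCos_eq_nsmul (q : ℕ) (s : UnitAddCircle) : circleCos q s = circleCos 1 (q • s) := by
  obtain ⟨x, rfl⟩ := QuotientAddGroup.mk_surjective s
  have : circleCos 1 (q • (x : UnitAddCircle)) = circleCos 1 ((q • x : ℝ) : UnitAddCircle) := rfl
  refine Eq.trans ?_ this.symm
  refine (circleCos_coe q x).trans ((circleCos_coe 1 _).trans ?_).symm
  simp only [Nat.cast_one, nsmul_eq_mul]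
  ring_nf

theorem continuous_circleCos (q : ℕ) : Continuous (circleCos q) := by
  rw [(QuotientAddGroup.isQuotientMap_mk (N := AddSubgroup.zmultiples (1 : ℝ))).continuous_iff]
  change Continuous fun x : ℝ => Real.cos (2 * Real.pi * q * x)
  fun_prop

open FourierTransform in
theorem fourier_coe_eq (n : ℤ) (x : ℝ) :
    fourier n (x : UnitAddCircle) = (𝐞 (n * x) : ℂ) := by
  rw [fourier_coe_apply, Real.fourierChar_apply]
  congr 1
  push_cast
  ring

/-! ### Homeomorphisms preserving the measure -/

/-- A measure preserving homeomorphism of the torus. -/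
structure IsMeasHomeo (H : Equiv.Perm Torus) : Prop where
  continuous : Continuous H
  continuous_symm : Continuous H.symm
  measurePreserving : MeasurePreserving H volume volume

theorem IsMeasHomeo.measurePreserving_symm {H : Equiv.Perm Torus} (h : IsMeasHomeo H) :
    MeasurePreserving H.symm volume volume :=
  let e : Torus ≃ᵐ Torus :=
    { H with
      measurable_toFun := h.continuous.measurable
      measurable_invFun := h.continuous_symm.measurable }
  MeasurePreserving.symm e h.measurePreserving

theorem IsMeasHomeo.symm {H : Equiv.Perm Torus} (h : IsMeasHomeo H) : IsMeasHomeo H⁻¹ :=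
  ⟨h.continuous_symm, h.continuous, h.measurePreserving_symm⟩

theorem IsMeasHomeo.mul {H K : Equiv.Perm Torus} (h : IsMeasHomeo H) (k : IsMeasHomeo K) :
    IsMeasHomeo (H * K) :=
  ⟨h.continuous.comp k.continuous, k.continuous_symm.comp h.continuous_symm,
    h.measurePreserving.comp k.measurePreserving⟩

theorem isMeasHomeo_one : IsMeasHomeo 1 :=
  ⟨continuous_id, continuous_id, MeasurePreserving.id _⟩

theorem isMeasHomeo_rot (t : ℝ) : IsMeasHomeo (rot t) where
  continuous := by
    simp only [rot, Equiv.coe_fn_mk]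
    fun_prop
  continuous_symm := by
    simp only [rot, Equiv.coe_fn_symm_mk]
    fun_prop
  measurePreserving :=
    (measurePreserving_add_right volume (t : UnitAddCircle)).prod (MeasurePreserving.id volume)

theorem isMeasHomeo_phi (q : ℕ) : IsMeasHomeo (phi q) := by
  have hc : Continuous fun x : UnitAddCircle =>
      (((q : ℝ) ^ 2 * circleCos q x : ℝ) : UnitAddCircle) :=
    (AddCircle.continuous_mk' _).comp (continuous_const.mul (continuous_circleCos q))
  refine ⟨?_, ?_, ?_⟩
  · simp only [phi, Equiv.coe_fn_mk]
    exact continuous_fst.prodMk (continuous_snd.add (hc.comp continuous_fst))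
  · simp only [phi, Equiv.coe_fn_symm_mk]
    exact continuous_fst.prodMk (continuous_snd.sub (hc.comp continuous_fst))
  · refine MeasurePreserving.skew_product (f := id)
      (g := fun a c => c + (((q : ℝ) ^ 2 * circleCos q a : ℝ) : UnitAddCircle))
      (MeasurePreserving.id volume) ?_ ?_
    · exact (continuous_snd.add (hc.comp continuous_fst)).measurable
    · exact ae_of_all _ fun a => (measurePreserving_add_right volume _).map_eq

theorem isMeasHomeo_shear (b : ℤ) : IsMeasHomeo (shear b) := by
  refine ⟨?_, ?_, ?_⟩
  · simp only [shear, Equiv.coe_fn_mk]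
    fun_prop
  · simp only [shear, Equiv.coe_fn_symm_mk]
    fun_prop
  · have h : MeasurePreserving (fun x : Torus => (x.1, x.2 + b • x.1)) volume volume := by
      refine MeasurePreserving.skew_product (f := id)
        (g := fun a c => c + b • a) (MeasurePreserving.id volume) ?_ ?_
      · exact (by fun_prop : Continuous fun x : Torus => x.2 + b • x.1).measurable
      · exact ae_of_all _ fun a => (measurePreserving_add_right volume _).map_eq
    -- The shear acts along the first factor; swapping the coordinates makes it a skew product over
    -- the identity.
    have hs : MeasurePreserving (Prod.swap : Torus → Torus) volume volume :=
      Measure.measurePreserving_swap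
    exact (hs.comp h).comp hs

theorem isMeasHomeo_HMap (σ : ℝ) (q : ℕ → ℕ) (n : ℕ) : IsMeasHomeo (HMap σ q n) := by
  induction n with
  | zero => exact isMeasHomeo_one
  | succ n ih => exact ih.mul ((isMeasHomeo_shear _).mul (isMeasHomeo_phi _))

/-! ### Decay of correlations -/

section Correlation

variable {X : Type*} [TopologicalSpace X] [CompactSpace X] [MeasurableSpace X] [BorelSpace X]

theorem integrable_correlation (μ : Measure X) [IsProbabilityMeasure μ] {T : X → X}
    (hT : Measurable T) (u v : C(X, ℂ)) : Integrable (fun x => u (T x) * v x) μ := by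
  refine Integrable.of_bound (C := ‖u‖ * ‖v‖) ?_ (ae_of_all _ fun x => ?_)
  · exact ((u.continuous.measurable.comp hT).mul v.continuous.measurable).aestronglyMeasurable
  · rw [norm_mul]
    exact mul_le_mul (u.norm_coe_le_norm _) (v.norm_coe_le_norm _) (norm_nonneg _) (norm_nonneg _)

theorem integrable_continuousMap (μ : Measure X) [IsProbabilityMeasure μ] (u : C(X, ℂ)) :
    Integrable u μ := by
  simpa using integrable_correlation μ measurable_id u 1

/-- The bilinear form `∫ (u ∘ T) v - (∫ u) (∫ v)` on continuous functions. -/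
noncomputable def correlation (μ : Measure X) [IsProbabilityMeasure μ] {T : X → X}
    (hT : Measurable T) : C(X, ℂ) →ₗ[ℂ] C(X, ℂ) →ₗ[ℂ] ℂ :=
  LinearMap.mk₂ ℂ (fun u v => ∫ x, u (T x) * v x ∂μ - (∫ x, u x ∂μ) * ∫ x, v x ∂μ)
    (by
      intro u u' v
      have h1 := integral_add (integrable_correlation μ hT u v) (integrable_correlation μ hT u' v)
      have h2 := integral_add (integrable_continuousMap μ u) (integrable_continuousMap μ u')
      simp only [ContinuousMap.add_apply, add_mul, h1, h2]
      ring)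
    (by
      intro c u v
      simp only [ContinuousMap.smul_apply, smul_eq_mul, mul_assoc, integral_const_mul]
      ring)
    (by
      intro u v v'
      have h1 := integral_add (integrable_correlation μ hT u v) (integrable_correlation μ hT u v')
      have h2 := integral_add (integrable_continuousMap μ v) (integrable_continuousMap μ v')
      simp only [ContinuousMap.add_apply, mul_add, h1, h2]
      ring)
    (by
      intro c u v
      simp only [ContinuousMap.smul_apply, smul_eq_mul, mul_left_comm _ c, integral_const_mul]
      ring)

theorem norm_correlation_le (μ : Measure X) [IsProbabilityMeasure μ] {T : X → X}
    (hT : Measurable T) (u v : C(X, ℂ)) : ‖correlation μ hT u v‖ ≤ 2 * ‖u‖ * ‖v‖ := by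
  have h1 : ‖∫ x, u (T x) * v x ∂μ‖ ≤ ‖u‖ * ‖v‖ := by
    have := norm_integral_le_of_norm_le_const (μ := μ) (f := fun x => u (T x) * v x)
      (C := ‖u‖ * ‖v‖) (ae_of_all _ fun x => by
        rw [norm_mul]
        exact mul_le_mul (u.norm_coe_le_norm _) (v.norm_coe_le_norm _) (norm_nonneg _)
          (norm_nonneg _))
    simpa using this
  have h2 : ∀ w : C(X, ℂ), ‖∫ x, w x ∂μ‖ ≤ ‖w‖ := by
    intro w
    have := norm_integral_le_of_norm_le_const (μ := μ) (f := w)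
      (C := ‖w‖) (ae_of_all _ fun x => w.norm_coe_le_norm x)
    simpa using this
  calc _ ≤ ‖∫ x, u (T x) * v x ∂μ‖ + ‖(∫ x, u x ∂μ) * ∫ x, v x ∂μ‖ := norm_sub_le _ _
    _ ≤ ‖u‖ * ‖v‖ + ‖u‖ * ‖v‖ := by
        rw [norm_mul]
        gcongr
        · exact h2 u
        · exact h2 v
    _ = _ := by ring

end Correlation

/-- Pointwise convergence of uniformly bounded functionals passes from a set to the closure of its
span. It is used in each argument of `correlation`, both for characters and for a dense sequence. -/
theorem tendsto_zero_of_span_dense {E ι : Type*} [NormedAddCommGroup E] [NormedSpace ℂ E]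
    {l : Filter ι} (L : ι → E →ₗ[ℂ] ℂ) {C : ℝ} (hC : ∀ i u, ‖L i u‖ ≤ C * ‖u‖) {S : Set E}
    (hS : (Submodule.span ℂ S).topologicalClosure = ⊤)
    (h : ∀ u ∈ S, Tendsto (fun i => L i u) l (𝓝 0)) (u : E) :
    Tendsto (fun i => L i u) l (𝓝 0) := by
  have hspan : ∀ u ∈ Submodule.span ℂ S, Tendsto (fun i => L i u) l (𝓝 0) := by
    intro u hu
    induction hu using Submodule.span_induction with
    | mem x hx => exact h x hx
    | zero => simp [tendsto_const_nhds]
    | add x y _ _ hx hy => simpa using hx.add hy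
    | smul a x _ hx => simpa using hx.const_mul a
  have hu : u ∈ closure (Submodule.span ℂ S : Set E) := by
    rw [← Submodule.topologicalClosure_coe, hS]
    trivial
  rw [Metric.tendsto_nhds]
  intro ε hε
  have hC' : 0 < |C| + 1 := by positivity
  obtain ⟨w, hw, hwu⟩ := Metric.mem_closure_iff.1 hu (ε / 2 / (|C| + 1)) (by positivity)
  filter_upwards [(Metric.tendsto_nhds.1 (hspan w hw)) (ε / 2) (by positivity)] with i hi
  rw [dist_zero_right] at hi ⊢
  rw [dist_eq_norm, lt_div_iff₀ hC'] at hwu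
  have h1 : L i u = L i (u - w) + L i w := by rw [map_sub]; ring
  have h2 : ‖L i (u - w)‖ < ε / 2 := by
    refine (hC i (u - w)).trans_lt (lt_of_le_of_lt ?_ hwu)
    nlinarith [norm_nonneg (u - w), le_abs_self C]
  rw [h1]
  linarith [norm_add_le (L i (u - w)) (L i w)]

theorem tendsto_correlation_of_span_dense {X ι : Type*} [TopologicalSpace X] [CompactSpace X]
    [MeasurableSpace X] [BorelSpace X] (μ : Measure X) [IsProbabilityMeasure μ] {l : Filter ι}
    {T : ι → X → X} (hT : ∀ i, Measurable (T i)) {S : Set C(X, ℂ)}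
    (hS : (Submodule.span ℂ S).topologicalClosure = ⊤)
    (h : ∀ u ∈ S, ∀ v ∈ S, Tendsto (fun i => correlation μ (hT i) u v) l (𝓝 0))
    (u v : C(X, ℂ)) : Tendsto (fun i => correlation μ (hT i) u v) l (𝓝 0) := by
  refine tendsto_zero_of_span_dense (fun i => (correlation μ (hT i)).flip v) (C := 2 * ‖v‖)
    (fun i w => ?_) hS (fun w hw => ?_) u
  · refine (norm_correlation_le μ (hT i) w v).trans (le_of_eq (by ring))
  · exact tendsto_zero_of_span_dense (fun i => correlation μ (hT i) w) (C := 2 * ‖w‖)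
      (fun i w' => norm_correlation_le μ (hT i) w w') hS (fun w' hw' => h w hw w' hw') v

/-- The characters of the torus. -/
noncomputable def character (k : ℤ × ℤ) : C(Torus, ℂ) :=
  ⟨fun x => fourier k.1 x.1 * fourier k.2 x.2, by fun_prop⟩

theorem character_apply (k : ℤ × ℤ) (x : Torus) :
    character k x = fourier k.1 x.1 * fourier k.2 x.2 := rfl

/-- Stone–Weierstrass: the span of the characters is a point-separating star subalgebra. -/
theorem span_character_closure_eq_top :
    (Submodule.span ℂ (Set.range character)).topologicalClosure = ⊤ := by
  let A : StarSubalgebra ℂ C(Torus, ℂ) :=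
    { toSubalgebra := Algebra.adjoin ℂ (Set.range character)
      star_mem' := by
        change Algebra.adjoin ℂ (Set.range character) ≤ star (Algebra.adjoin ℂ (Set.range character))
        refine Algebra.adjoin_le ?_
        rintro _ ⟨n, rfl⟩
        refine Algebra.subset_adjoin ⟨-n, ?_⟩
        ext1 x
        simp only [character_apply, Prod.fst_neg, Prod.snd_neg, fourier_neg,
          ContinuousMap.star_apply, RCLike.star_def, map_mul] }
  have hA : A.toSubalgebra.toSubmodule = Submodule.span ℂ (Set.range character) := by
    apply Algebra.adjoin_eq_span_of_subset
    refine .trans (fun x ↦ Submonoid.closure_induction (fun _ ↦ id) ⟨0, ?_⟩ ?_)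
      Submodule.subset_span
    · ext z
      simp [character_apply]
    · rintro _ _ _ _ ⟨m, rfl⟩ ⟨n, rfl⟩
      refine ⟨m + n, ?_⟩
      ext z
      simp only [character_apply, ContinuousMap.mul_apply, Prod.fst_add, Prod.snd_add, fourier_add]
      ring
  have hsep : A.SeparatesPoints := by
    have h0 : ∀ a b : UnitAddCircle, fourier 1 a = (fourier 1 b : ℂ) → a = b := by
      intro a b hab
      rw [fourier_one, fourier_one] at hab
      exact AddCircle.injective_toCircle one_ne_zero (Subtype.coe_injective hab)
    intro x y hxy
    by_cases h1 : x.1 = y.1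
    · refine ⟨_, ⟨character (0, 1), Algebra.subset_adjoin ⟨_, rfl⟩, rfl⟩, ?_⟩
      intro h
      simp only [character_apply, fourier_zero, one_mul] at h
      exact hxy (Prod.ext h1 (h0 _ _ h))
    · refine ⟨_, ⟨character (1, 0), Algebra.subset_adjoin ⟨_, rfl⟩, rfl⟩, ?_⟩
      intro h
      simp only [character_apply, fourier_zero, mul_one] at h
      exact h1 (h0 _ _ h)
  have := ContinuousMap.starSubalgebra_topologicalClosure_eq_top_of_separatesPoints A hsep
  rw [← hA]
  exact congr_arg (Subalgebra.toSubmodule <| StarSubalgebra.toSubalgebra ·) this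

/-! ### Correlations of characters under half-period conjugates -/

instance : IsProbabilityMeasure (volume : Measure UnitAddCircle) := ⟨by simp⟩

instance : IsProbabilityMeasure (volume : Measure Torus) :=
  inferInstanceAs (IsProbabilityMeasure (Measure.prod volume volume))

theorem IsMeasHomeo.integral_comp {H : Equiv.Perm Torus} (h : IsMeasHomeo H) (g : Torus → ℂ) :
    ∫ x, g (H x) = ∫ x, g x :=
  let e : Torus ≃ₜ Torus :=
    { H with
      continuous_toFun := h.continuous
      continuous_invFun := h.continuous_symm }
  h.measurePreserving.integral_comp e.measurableEmbedding g

theorem fourier_apply_add (n : ℤ) (x y : UnitAddCircle) :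
    fourier n (x + y) = (fourier n x * fourier n y : ℂ) := by
  simp only [fourier_apply, smul_add, AddCircle.toCircle_add, Circle.coe_mul]

theorem fourier_apply_zsmul (n b : ℤ) (x : UnitAddCircle) :
    fourier n (b • x) = (fourier (n * b) x : ℂ) := by
  simp only [fourier_apply, mul_zsmul]

theorem integral_fourier {n : ℤ} (hn : n ≠ 0) :
    ∫ x : UnitAddCircle, (fourier n x : ℂ) = 0 :=
  integral_eq_zero_of_add_right_eq_neg (fourier_add_half_inv_index hn one_pos)

theorem circleCos_add_half {q : ℕ} (hq : 0 < q) (s : UnitAddCircle) :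
    circleCos q (s + ((1 / (2 * q) : ℝ) : UnitAddCircle)) = -circleCos q s := by
  obtain ⟨x, rfl⟩ := QuotientAddGroup.mk_surjective s
  have hq' : (q : ℝ) ≠ 0 := by positivity
  have : 2 * Real.pi * q * (x + 1 / (2 * q)) = 2 * Real.pi * q * x + Real.pi := by
    field_simp
  refine (circleCos_coe q (x + 1 / (2 * q))).trans ?_
  rw [this, Real.cos_add_pi]
  rfl

/-- The conjugate `h R_t h⁻¹` of the half-period translation `t = 1 / (2 q)` by
`h = shear b * phi q`. -/
noncomputable def halfShift (b : ℤ) (q : ℕ) : Equiv.Perm Torus :=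
  (shear b * phi q) * rot (1 / (2 * q)) * (shear b * phi q)⁻¹

theorem isMeasHomeo_halfShift (b : ℤ) (q : ℕ) : IsMeasHomeo (halfShift b q) :=
  (((isMeasHomeo_shear b).mul (isMeasHomeo_phi q)).mul (isMeasHomeo_rot _)).mul
    ((isMeasHomeo_shear b).mul (isMeasHomeo_phi q)).symm

/-- Undoing `phi`, translating by half a period and redoing `phi` subtracts the cosine term twice,
because the translation reverses its sign. -/
theorem halfShift_shear {q : ℕ} (hq : 0 < q) (b : ℤ) (x : Torus) :
    halfShift b q (shear b x) =
      shear b (x.1 + ((1 / (2 * q) : ℝ) : UnitAddCircle),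
        x.2 + ((-(2 * (q : ℝ) ^ 2 * circleCos q x.1) : ℝ) : UnitAddCircle)) := by
  have e1 : halfShift b q (shear b x) =
      shear b (phi q (rot (1 / (2 * q)) ((phi q).symm ((shear b).symm (shear b x))))) := rfl
  rw [e1, Equiv.symm_apply_apply]
  congr 1
  simp only [phi, rot, Equiv.coe_fn_mk, Equiv.coe_fn_symm_mk, circleCos_add_half hq]
  ext1
  · rfl
  · simp only [sub_eq_add_neg, add_assoc, ← AddCircle.coe_neg, ← AddCircle.coe_add]
    congr 2
    ring

theorem integral_character {k : ℤ × ℤ} (hk : k ≠ 0) : ∫ x, character k x = 0 := by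
  simp only [character_apply]
  have h := integral_prod_mul (μ := (volume : Measure UnitAddCircle))
    (ν := (volume : Measure UnitAddCircle)) (fun s => (fourier k.1 s : ℂ))
    (fun r => (fourier k.2 r : ℂ))
  refine Eq.trans h ?_
  by_cases h1 : k.1 = 0
  · have h2 : k.2 ≠ 0 := fun h2 => hk (Prod.ext h1 h2)
    rw [integral_fourier h2, mul_zero]
  · rw [integral_fourier h1, zero_mul]

open FourierTransform in
-- In the coordinates before the shear the integrand splits into a function of `θ` times a character
-- in `r` of frequency `(k.1 + k'.1) b + (k.2 + k'.2)`. If the frequency is nonzero the integral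
-- vanishes. As `b` exceeds `|k.2 + k'.2|`, a zero frequency forces `k.1 + k'.1 = 0`, and only the
-- oscillation of the cosine is left.
theorem integral_character_halfShift {q : ℕ} (hq : 1 < q) (b : ℤ) (k k' : ℤ × ℤ)
    (hb : |k.2 + k'.2| < b) :
    ‖∫ x, character k (halfShift b q x) * character k' x‖ ≤
      ‖∫ s : UnitAddCircle, (𝐞 (-(circleCos 1 s * (2 * (q : ℝ) ^ 2 * (k.1 * b + k.2 : ℤ)))) : ℂ)‖ := by
  have hq0 : 0 < q := by omega
  rw [← (isMeasHomeo_shear b).integral_comp]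
  set t : UnitAddCircle := ((1 / (2 * q) : ℝ) : UnitAddCircle) with ht
  set A : UnitAddCircle → UnitAddCircle :=
    fun s => ((-(2 * (q : ℝ) ^ 2 * circleCos q s) : ℝ) : UnitAddCircle) with hA
  have key : ∀ x : Torus, character k (halfShift b q (shear b x)) * character k' (shear b x) =
      (fourier k.1 t * (fourier (k.1 + k'.1) x.1 * fourier (k.1 * b + k.2) (A x.1))) *
        fourier ((k.1 + k'.1) * b + (k.2 + k'.2)) x.2 := by
    intro x
    rw [halfShift_shear hq0]
    simp only [character_apply, shear, Equiv.coe_fn_mk, fourier_apply_add, fourier_apply_zsmul,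
      fourier_add, add_mul]
    ring
  simp only [key]
  have h := integral_prod_mul (μ := (volume : Measure UnitAddCircle))
    (ν := (volume : Measure UnitAddCircle))
    (fun s => (fourier k.1 t * (fourier (k.1 + k'.1) s * fourier (k.1 * b + k.2) (A s)) : ℂ))
    (fun r => (fourier ((k.1 + k'.1) * b + (k.2 + k'.2)) r : ℂ))
  refine (le_of_eq (congrArg norm h)).trans ?_
  by_cases hN : (k.1 + k'.1) * b + (k.2 + k'.2) = 0
  · have hk : k.1 + k'.1 = 0 := by
      by_contra h0
      have h1 : 1 ≤ |k.1 + k'.1| := Int.one_le_abs h0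
      have h2 : |(k.1 + k'.1) * b| = |k.2 + k'.2| := by
        rw [eq_neg_of_add_eq_zero_left hN, abs_neg]
      rw [abs_mul] at h2
      have h3 := le_abs_self b
      nlinarith [abs_nonneg b]
    rw [hN, hk]
    simp only [fourier_zero, one_mul, integral_const_mul, norm_mul]
    have h1 : ‖(fourier k.1 t : ℂ)‖ = 1 := by rw [fourier_apply, Circle.norm_coe]
    have h2 : ‖∫ _ : UnitAddCircle, (1 : ℂ)‖ = 1 := by simp
    rw [h1, h2, one_mul, mul_one]
    apply le_of_eq
    congr 1
    -- Multiplication by `q` preserves Haar measure, so `cos(2πqs)` may be replaced by `cos(2πs)`.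
    have hmp : MeasurePreserving (fun s : UnitAddCircle => q • s) volume volume :=
      (AddCircle.ergodic_nsmul hq).toMeasurePreserving
    have hc := continuous_circleCos 1
    have h3 : ∀ s, (fourier (k.1 * b + k.2) (A s) : ℂ) =
        𝐞 (-(circleCos 1 (q • s) * (2 * (q : ℝ) ^ 2 * (k.1 * b + k.2 : ℤ)))) := by
      intro s
      rw [hA]
      simp only [fourier_coe_eq, circleCos_eq_nsmul q s]
      ring_nf
    simp only [h3]
    conv_rhs => rw [← hmp.map_eq]
    rw [integral_map hmp.measurable.aemeasurable]
    exact (by fun_prop : Continuous fun s : UnitAddCircle =>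
      (𝐞 (-(circleCos 1 s * (2 * (q : ℝ) ^ 2 * (k.1 * b + k.2 : ℤ)))) : ℂ)).aestronglyMeasurable
  · rw [integral_fourier hN, mul_zero, norm_zero]
    exact norm_nonneg _

theorem tendsto_correlation_character {b : ℕ → ℤ} (hb : Tendsto b atTop atTop)
    (k k' : ℤ × ℤ) :
    Tendsto (fun q => correlation volume
      (isMeasHomeo_halfShift (b q) q).continuous.measurable (character k) (character k'))
      atTop (𝓝 0) := by
  have happ : ∀ q, correlation volume
      (isMeasHomeo_halfShift (b q) q).continuous.measurable (character k) (character k') =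
      (∫ x, character k (halfShift (b q) q x) * character k' x) -
        (∫ x, character k x) * ∫ x, character k' x := fun q => rfl
  simp only [happ]
  by_cases hk : k = 0
  · have h1 : ∀ x, character k x = 1 := by
      intro x
      simp [hk, character_apply]
    simp [h1]
  simp only [integral_character hk, zero_mul, sub_zero]
  have hM : ∀ᶠ q in atTop, k.1 * b q + k.2 ≠ 0 := by
    filter_upwards [hb.eventually_gt_atTop |k.2|] with q hq h0
    by_cases h1 : k.1 = 0
    · rw [h1, zero_mul, zero_add] at h0
      exact hk (Prod.ext h1 h0)
    · have h2 : 1 ≤ |k.1| := Int.one_le_abs h1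
      have h3 : |k.1 * b q| = |k.2| := by rw [eq_neg_of_add_eq_zero_left h0, abs_neg]
      rw [abs_mul] at h3
      have h4 := le_abs_self (b q)
      nlinarith [abs_nonneg (b q)]
  -- A nonzero integer has modulus at least 1, so the amplitude `q²` alone drives the phase to
  -- infinity. This matters when `k.1 = 0`, where `b` contributes nothing.
  have hco : Tendsto (fun q : ℕ => (2 * (q : ℝ) ^ 2 * (k.1 * b q + k.2 : ℤ)))
      atTop (cocompact ℝ) := by
    rw [← Metric.cobounded_eq_cocompact, ← tendsto_norm_atTop_iff_cobounded]
    refine tendsto_atTop_mono' _ ?_ tendsto_natCast_atTop_atTop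
    filter_upwards [hM, eventually_ge_atTop 1] with q hq hq1
    have h1 : (1 : ℝ) ≤ |((k.1 * b q + k.2 : ℤ) : ℝ)| := by
      exact_mod_cast Int.one_le_abs hq
    have h2 : (1 : ℝ) ≤ q := by exact_mod_cast hq1
    rw [norm_mul, Real.norm_eq_abs, Real.norm_eq_abs, abs_of_nonneg (by positivity)]
    nlinarith
  have hJ := (tendsto_integral_fourierChar_circleCos.comp hco).norm
  rw [norm_zero] at hJ
  refine squeeze_zero_norm' ?_ hJ
  filter_upwards [eventually_gt_atTop 1, hb.eventually_gt_atTop |k.2 + k'.2|] with q hq hbq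
  exact integral_character_halfShift hq (b q) k k' hbq

/-- The maps `halfShift (b q) q` become mixing as `q → ∞`, even after a fixed change of
coordinates `H`. -/
theorem tendsto_correlation_conj_halfShift {b : ℕ → ℤ} (hb : Tendsto b atTop atTop)
    {H : Equiv.Perm Torus} (hH : IsMeasHomeo H) (u v : C(Torus, ℂ)) :
    Tendsto (fun q => correlation volume
      ((hH.mul (isMeasHomeo_halfShift (b q) q)).mul hH.symm).continuous.measurable u v)
      atTop (𝓝 0) := by
  let e : C(Torus, Torus) := ⟨H, hH.continuous⟩
  have h := tendsto_correlation_of_span_dense (l := atTop) (volume : Measure Torus)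
    (fun q => (isMeasHomeo_halfShift (b q) q).continuous.measurable)
    span_character_closure_eq_top (by
      rintro _ ⟨k, rfl⟩ _ ⟨k', rfl⟩
      exact tendsto_correlation_character hb k k') (u.comp e) (v.comp e)
  -- Since `H` preserves the measure, conjugating by `H` amounts to testing against `u ∘ H` and `v ∘
  -- H`.
  refine h.congr fun q => ?_
  have h1 : ∀ w : C(Torus, ℂ), ∫ x, w (e x) = ∫ x, w x := fun w => hH.integral_comp w
  have h2 := hH.integral_comp
    (fun x => u ((H * halfShift (b q) q * H⁻¹ : Equiv.Perm Torus) x) * v x)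
  have h3 : ∀ x, (H * halfShift (b q) q * H⁻¹ : Equiv.Perm Torus) (H x) =
      H (halfShift (b q) q x) := by
    intro x
    simp [Equiv.Perm.mul_apply]
  simp only [h3] at h2
  change (∫ x, (u.comp e) (halfShift (b q) q x) * (v.comp e) x) -
    (∫ x, (u.comp e) x) * ∫ x, (v.comp e) x = _
  simp only [ContinuousMap.comp_apply, h1]
  exact congrArg (· - (∫ x, u x) * ∫ x, v x) h2

/-! ### Rational rotations approximate all rotations -/

theorem exists_rot_approx {p : ℤ} {q : ℕ} (hq : 0 < q) (hpq : IsCoprime p (q : ℤ)) (t : ℝ) :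
    ∃ m : ℕ, m ≤ q ∧ ∀ x, dist (rot (m * ((p : ℝ) / q)) x) (rot t x) ≤ 1 / q := by
  obtain ⟨u, v, huv⟩ := hpq
  have hq0 : (q : ℤ) ≠ 0 := by exact_mod_cast hq.ne'
  have hqR : (0 : ℝ) < q := by exact_mod_cast hq
  -- Since `u` inverts `p` modulo `q`, the choice `m ≡ u a` makes `m p / q` equal to `a / q` modulo
  -- 1, and `a / q` is within `1 / q` of `t`.
  set a := ⌊t * q⌋ with ha
  have hm0 := Int.emod_nonneg (u * a) hq0
  have hmq := Int.emod_lt_of_pos (u * a) (show (0 : ℤ) < q by exact_mod_cast hq)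
  refine ⟨((u * a) % q).toNat, by omega, fun x => ?_⟩
  have hcast : ((((u * a) % q).toNat : ℕ) : ℝ) = (((u * a) % q : ℤ) : ℝ) := by
    have : ((((u * a) % q).toNat : ℕ) : ℤ) = (u * a) % q := Int.toNat_of_nonneg hm0
    exact_mod_cast congrArg (fun z : ℤ => (z : ℝ)) this
  obtain ⟨l, hl⟩ : ∃ l : ℤ, ((u * a) % q) * p = a + q * l := by
    refine ⟨-(v * a) - (u * a / q) * p, ?_⟩
    rw [Int.emod_def]
    linear_combination a * huv
  have hmp : (((u * a) % q : ℤ) : ℝ) * ((p : ℝ) / q) = (a : ℝ) / q + l := by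
    have : (((u * a) % q : ℤ) : ℝ) * p = a + q * l := by exact_mod_cast hl
    field_simp
    linarith
  rw [hcast, hmp]
  have hd : dist (x.1 + (((a : ℝ) / q + l : ℝ) : UnitAddCircle)) (x.1 + (t : UnitAddCircle)) ≤
      1 / q := by
    rw [dist_add_left, dist_comm, dist_eq_norm, ← AddCircle.coe_sub]
    have h1 : ((t - ((a : ℝ) / q + l) : ℝ) : UnitAddCircle) =
        ((t - (a : ℝ) / q : ℝ) : UnitAddCircle) := by
      simp
    rw [h1]
    refine QuotientAddGroup.norm_mk_le_norm.trans ?_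
    have h2 := Int.floor_le (t * q)
    have h3 := Int.lt_floor_add_one (t * q)
    have h4 : t - (a : ℝ) / q = (t * q - a) / q := by field_simp
    rw [h4, Real.norm_eq_abs, abs_of_nonneg (div_nonneg (by linarith) hqR.le)]
    gcongr
    linarith
  rw [Prod.dist_eq]
  refine max_le hd ?_
  simp only [rot, Equiv.coe_fn_mk, dist_self]
  positivity

theorem eventually_exists_conj_rot_approx {H : Equiv.Perm Torus} (hH : Continuous H) (t : ℝ)
    {ε : ℝ} (hε : 0 < ε) :
    ∀ᶠ q : ℕ in atTop, ∀ p : ℤ, IsCoprime p (q : ℤ) → ∃ m : ℕ, m ≤ q ∧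
      ∀ x, dist ((H * rot (m * ((p : ℝ) / q)) * H⁻¹ : Equiv.Perm Torus) x)
        ((H * rot t * H⁻¹ : Equiv.Perm Torus) x) ≤ ε := by
  have huc := CompactSpace.uniformContinuous_of_continuous hH
  obtain ⟨η, hη, hη'⟩ := Metric.uniformContinuous_iff.1 huc ε hε
  have hlim : Tendsto (fun q : ℕ => (1 : ℝ) / q) atTop (𝓝 0) := tendsto_one_div_atTop_nhds_zero_nat
  filter_upwards [hlim.eventually (gt_mem_nhds hη), eventually_gt_atTop 0] with q hq hq0 p hp
  obtain ⟨m, hm, hmd⟩ := exists_rot_approx hq0 hp t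
  refine ⟨m, hm, fun x => ?_⟩
  exact (hη' ((hmd (H⁻¹ x)).trans_lt hq)).le

/-! ### A criterion for weak mixing -/

section Criterion

variable {X : Type*} [PseudoMetricSpace X] [CompactSpace X] [MeasurableSpace X] [BorelSpace X]

theorem tendsto_correlation_of_dist_le (μ : Measure X) [IsProbabilityMeasure μ] {ι : Type*}
    {l : Filter ι} {S T : ι → X → X} (hS : ∀ i, Measurable (S i)) (hT : ∀ i, Measurable (T i))
    {d : ι → ℝ} (hd : Tendsto d l (𝓝 0)) (hST : ∀ᶠ i in l, ∀ x, dist (T i x) (S i x) ≤ d i)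
    (u v : C(X, ℂ)) (h : Tendsto (fun i => correlation μ (hS i) u v) l (𝓝 0)) :
    Tendsto (fun i => correlation μ (hT i) u v) l (𝓝 0) := by
  have hdiff : Tendsto (fun i => correlation μ (hT i) u v - correlation μ (hS i) u v) l (𝓝 0) := by
    rw [Metric.tendsto_nhds]
    intro ε hε
    have huc := CompactSpace.uniformContinuous_of_continuous u.continuous
    obtain ⟨η, hη, hη'⟩ := Metric.uniformContinuous_iff.1 huc (ε / 2 / (‖v‖ + 1)) (by positivity)
    filter_upwards [hd.eventually (gt_mem_nhds hη), hST] with i hi hdi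
    rw [dist_zero_right]
    have e : correlation μ (hT i) u v - correlation μ (hS i) u v =
        ∫ x, (u (T i x) - u (S i x)) * v x ∂μ := by
      have := integral_sub (integrable_correlation μ (hT i) u v)
        (integrable_correlation μ (hS i) u v)
      simp only [sub_mul, this]
      change (_ - (∫ x, u x ∂μ) * ∫ x, v x ∂μ) - (_ - (∫ x, u x ∂μ) * ∫ x, v x ∂μ) = _
      ring
    rw [e]
    have := norm_integral_le_of_norm_le_const (μ := μ)
      (f := fun x => (u (T i x) - u (S i x)) * v x) (C := ε / 2 / (‖v‖ + 1) * ‖v‖)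
      (ae_of_all _ fun x => by
        rw [norm_mul]
        have h1 := (hη' ((hdi x).trans_lt hi)).le
        rw [dist_eq_norm] at h1
        exact mul_le_mul h1 (v.norm_coe_le_norm _) (norm_nonneg _) (by positivity))
    refine this.trans_lt ?_
    have h2 : ε / 2 / (‖v‖ + 1) * ‖v‖ ≤ ε / 2 := by
      rw [div_mul_eq_mul_div, div_le_iff₀ (by positivity)]
      nlinarith [norm_nonneg v]
    simp only [probReal_univ, mul_one]
    linarith
  simpa using hdiff.add h

theorem exists_norm_sub_le_of_bounded (μ : Measure X) [IsProbabilityMeasure μ] {g : X → ℂ}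
    (hg : Measurable g) (hg1 : ∀ x, ‖g x‖ ≤ 1) {ε : ℝ} (hε : 0 < ε) :
    ∃ v : C(X, ℂ), ∫ x, ‖g x - v x‖ ∂μ ≤ ε := by
  have hi : Integrable g μ := Integrable.of_bound hg.aestronglyMeasurable 1 (ae_of_all _ hg1)
  obtain ⟨v, hv, -⟩ := hi.exists_boundedContinuous_integral_sub_le hε
  exact ⟨v.toContinuousMap, hv⟩

/-- Continuous functions are dense in `L¹`, and invariance of the measure transports the
approximation error along `T i`. The approximant `v` need not be bounded by 1, so `h` is
approximated to within `ε / (‖v‖ + 1)`. Four approximation errors and one correlation make up `5 ε`.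
-/
theorem correlation_bounded_le (μ : Measure X) [IsProbabilityMeasure μ] {g h : X → ℂ}
    (hg : Measurable g) (hg1 : ∀ x, ‖g x‖ ≤ 1) (hh : Measurable h) (hh1 : ∀ x, ‖h x‖ ≤ 1)
    {ι : Type*} {l : Filter ι} [l.NeBot] {T : ι → X → X} (hT : ∀ i, MeasurePreserving (T i) μ μ)
    (hmix : ∀ u v : C(X, ℂ), Tendsto (fun i => correlation μ (hT i).measurable u v) l (𝓝 0))
    {ε : ℝ} (hε : 0 < ε) :
    ∃ i, ‖∫ x, g (T i x) * h x ∂μ - (∫ x, g x ∂μ) * ∫ x, h x ∂μ‖ ≤ 5 * ε := by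
  obtain ⟨v, hv⟩ := exists_norm_sub_le_of_bounded μ hg hg1 hε
  obtain ⟨w, hw⟩ := exists_norm_sub_le_of_bounded μ hh hh1
    (show 0 < ε / (‖v‖ + 1) by positivity)
  have hvw : ‖v‖ * (ε / (‖v‖ + 1)) ≤ ε := by
    rw [← mul_div_assoc, div_le_iff₀ (by positivity)]
    nlinarith [norm_nonneg v]
  obtain ⟨i, hi⟩ := ((Metric.tendsto_nhds.1 (hmix v w)) ε hε).exists
  rw [dist_zero_right] at hi
  refine ⟨i, ?_⟩
  have ig : Integrable g μ := Integrable.of_bound hg.aestronglyMeasurable 1 (ae_of_all _ hg1)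
  have ih : Integrable h μ := Integrable.of_bound hh.aestronglyMeasurable 1 (ae_of_all _ hh1)
  have iv := integrable_continuousMap μ v
  have iw := integrable_continuousMap μ w
  have hgT : Measurable fun x => g (T i x) := hg.comp (hT i).measurable
  have hvT : Measurable fun x => v (T i x) := v.continuous.measurable.comp (hT i).measurable
  have i1 : Integrable (fun x => (g (T i x) - v (T i x)) * h x) μ := by
    refine Integrable.of_bound ((hgT.sub hvT).mul hh).aestronglyMeasurable (C := 1 + ‖v‖)
      (ae_of_all _ fun x => ?_)
    rw [norm_mul]
    have := norm_sub_le (g (T i x)) (v (T i x))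
    nlinarith [hg1 (T i x), hh1 x, v.norm_coe_le_norm (T i x), norm_nonneg (h x), norm_nonneg v,
      norm_nonneg (g (T i x) - v (T i x))]
  have i2 : Integrable (fun x => v (T i x) * (h x - w x)) μ := by
    refine Integrable.of_bound (hvT.mul (hh.sub w.continuous.measurable)).aestronglyMeasurable
      (C := ‖v‖ * (1 + ‖w‖)) (ae_of_all _ fun x => ?_)
    rw [norm_mul]
    have := norm_sub_le (h x) (w x)
    exact mul_le_mul (v.norm_coe_le_norm _) (by linarith [hh1 x, w.norm_coe_le_norm x])
      (norm_nonneg _) (norm_nonneg _)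
  have i3 := integrable_correlation μ (hT i).measurable v w
  have e1 : ∫ x, g (T i x) * h x ∂μ = ∫ x, (g (T i x) - v (T i x)) * h x ∂μ +
      (∫ x, v (T i x) * (h x - w x) ∂μ + ∫ x, v (T i x) * w x ∂μ) := by
    rw [← integral_add i2 i3]
    refine Eq.trans ?_ (integral_add i1 (i2.add i3))
    congr 1
    ext1 x
    ring
  have b1 : ‖∫ x, (g (T i x) - v (T i x)) * h x ∂μ‖ ≤ ε := by
    calc _ ≤ ∫ x, ‖g (T i x) - v (T i x)‖ ∂μ := by
          refine norm_integral_le_of_norm_le ?_ (ae_of_all _ fun x => ?_)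
          · exact (((hT i).integrable_comp (ig.sub iv).aestronglyMeasurable).2 (ig.sub iv)).norm
          · rw [norm_mul]
            exact mul_le_of_le_one_right (norm_nonneg _) (hh1 x)
      _ = ∫ x, ‖g x - v x‖ ∂μ := by
          have : AEStronglyMeasurable (fun x => ‖g x - v x‖) (μ.map (T i)) := by
            exact (hg.sub v.continuous.measurable).norm.aestronglyMeasurable
          conv_rhs => rw [← (hT i).map_eq]
          rw [integral_map (hT i).measurable.aemeasurable this]
      _ ≤ ε := hv
  have b2 : ‖∫ x, v (T i x) * (h x - w x) ∂μ‖ ≤ ε := by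
    calc _ ≤ ∫ x, ‖v‖ * ‖h x - w x‖ ∂μ := by
          refine norm_integral_le_of_norm_le ((ih.sub iw).norm.const_mul _)
            (ae_of_all _ fun x => ?_)
          rw [norm_mul]
          exact mul_le_mul_of_nonneg_right (v.norm_coe_le_norm _) (norm_nonneg _)
      _ = ‖v‖ * ∫ x, ‖h x - w x‖ ∂μ := integral_const_mul _ _
      _ ≤ ‖v‖ * (ε / (‖v‖ + 1)) := by gcongr
      _ ≤ ε := hvw
  have b3 : ‖(∫ x, g x ∂μ) - ∫ x, v x ∂μ‖ ≤ ε := by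
    rw [← integral_sub ig iv]
    exact (norm_integral_le_integral_norm _).trans hv
  have b4 : ‖(∫ x, h x ∂μ) - ∫ x, w x ∂μ‖ ≤ ε / (‖v‖ + 1) := by
    rw [← integral_sub ih iw]
    exact (norm_integral_le_integral_norm _).trans hw
  have b5 : ‖∫ x, v x ∂μ‖ ≤ ‖v‖ := by
    have := norm_integral_le_of_norm_le_const (μ := μ) (f := v)
      (C := ‖v‖) (ae_of_all _ fun x => v.norm_coe_le_norm x)
    simpa using this
  have b6 : ‖∫ x, h x ∂μ‖ ≤ 1 := by
    have := norm_integral_le_of_norm_le_const (μ := μ) (f := h)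
      (C := 1) (ae_of_all _ hh1)
    simpa using this
  have hcorr : correlation μ (hT i).measurable v w =
      ∫ x, v (T i x) * w x ∂μ - (∫ x, v x ∂μ) * ∫ x, w x ∂μ := rfl
  have e2 : ∫ x, g (T i x) * h x ∂μ - (∫ x, g x ∂μ) * ∫ x, h x ∂μ =
      ((∫ x, (g (T i x) - v (T i x)) * h x ∂μ) + (∫ x, v (T i x) * (h x - w x) ∂μ)) +
      (correlation μ (hT i).measurable v w -
        ((∫ x, v x ∂μ) * ((∫ x, h x ∂μ) - ∫ x, w x ∂μ) +
          ((∫ x, g x ∂μ) - ∫ x, v x ∂μ) * ∫ x, h x ∂μ)) := by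
    rw [e1, hcorr]
    ring
  have c1 : ‖(∫ x, v x ∂μ) * ((∫ x, h x ∂μ) - ∫ x, w x ∂μ)‖ ≤ ε := by
    rw [norm_mul]
    exact (mul_le_mul b5 b4 (norm_nonneg _) (norm_nonneg _)).trans hvw
  have c2 : ‖((∫ x, g x ∂μ) - ∫ x, v x ∂μ) * ∫ x, h x ∂μ‖ ≤ ε := by
    rw [norm_mul]
    exact (mul_le_mul b3 b6 (norm_nonneg _) hε.le).trans (by linarith)
  rw [e2]
  refine (norm_add_le _ _).trans ?_
  have d1 := norm_add_le (∫ x, (g (T i x) - v (T i x)) * h x ∂μ)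
    (∫ x, v (T i x) * (h x - w x) ∂μ)
  have d2 := norm_sub_le (correlation μ (hT i).measurable v w)
    ((∫ x, v x ∂μ) * ((∫ x, h x ∂μ) - ∫ x, w x ∂μ) +
          ((∫ x, g x ∂μ) - ∫ x, v x ∂μ) * ∫ x, h x ∂μ)
  have d3 := norm_add_le ((∫ x, v x ∂μ) * ((∫ x, h x ∂μ) - ∫ x, w x ∂μ))
    (((∫ x, g x ∂μ) - ∫ x, v x ∂μ) * ∫ x, h x ∂μ)
  linarith

/-- Along the iterates, the correlation of `g` with its conjugate has first term `c ^ m ∫ |g|²`, of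
constant modulus. Decay forces `∫ |g|² = |∫ g|²`, so `g` has variance zero. -/
theorem ae_const_of_bounded_eigenfunction (μ : Measure X) [IsProbabilityMeasure μ] {f : X → X}
    (hf : MeasurePreserving f μ μ) {ι : Type*} {l : Filter ι} [l.NeBot] {m : ι → ℕ}
    (hmix : ∀ u v : C(X, ℂ),
      Tendsto (fun i => correlation μ (hf.iterate (m i)).measurable u v) l (𝓝 0))
    {c : ℂ} (hc : ‖c‖ = 1) {g : X → ℂ} (hg : Measurable g) (hg1 : ∀ x, ‖g x‖ ≤ 1)
    (heig : ∀ᵐ x ∂μ, g (f x) = c * g x) : ∃ a : ℂ, ∀ᵐ x ∂μ, g x = a := by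
  have hiter : ∀ k : ℕ, ∀ᵐ x ∂μ, g (f^[k] x) = c ^ k * g x := by
    intro k
    induction k with
    | zero => simp
    | succ k ih =>
      filter_upwards [hf.quasiMeasurePreserving.ae ih, heig] with x h1 h2
      rw [Function.iterate_succ_apply, h1, h2]
      ring
  have hstar : Measurable fun x => (starRingEnd ℂ) (g x) := Complex.continuous_conj.measurable.comp hg
  set a := ∫ x, g x ∂μ with ha
  set s := ∫ x, g x * (starRingEnd ℂ) (g x) ∂μ with hs
  have ig : Integrable g μ := Integrable.of_bound hg.aestronglyMeasurable 1 (ae_of_all _ hg1)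
  have igs : Integrable (fun x => (starRingEnd ℂ) (g x)) μ :=
    Integrable.of_bound hstar.aestronglyMeasurable (C := 1) (ae_of_all _ fun x => by
      simpa using hg1 x)
  have igg : Integrable (fun x => g x * (starRingEnd ℂ) (g x)) μ :=
    Integrable.of_bound (hg.mul hstar).aestronglyMeasurable (C := 1) (ae_of_all _ fun x => by
      rw [norm_mul, RCLike.norm_conj]
      nlinarith [hg1 x, norm_nonneg (g x)])
  have hconj : ∫ x, (starRingEnd ℂ) (g x) ∂μ = (starRingEnd ℂ) a := integral_conj
  have hs' : s = ((∫ x, ‖g x‖ ^ 2 ∂μ : ℝ) : ℂ) := by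
    rw [hs, ← integral_complex_ofReal]
    congr 1
    ext1 x
    rw [Complex.mul_conj, Complex.normSq_eq_norm_sq]
  have hsn : ‖s‖ = ∫ x, ‖g x‖ ^ 2 ∂μ := by
    rw [hs', Complex.norm_real, Real.norm_of_nonneg]
    exact integral_nonneg fun x => by positivity
  have hclose : ∀ ε > 0, |‖s‖ - ‖a‖ ^ 2| ≤ 5 * ε := by
    intro ε hε
    obtain ⟨i, hi⟩ := correlation_bounded_le μ hg hg1 hstar
      (fun x => by simpa using hg1 x) (fun i => hf.iterate (m i)) hmix hε
    have e : ∫ x, g (f^[m i] x) * (starRingEnd ℂ) (g x) ∂μ = c ^ m i * s := by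
      rw [hs, ← integral_const_mul]
      apply integral_congr_ae
      filter_upwards [hiter (m i)] with x hx
      rw [hx]
      ring
    rw [e, hconj] at hi
    have h1 := abs_norm_sub_norm_le (c ^ m i * s) (a * (starRingEnd ℂ) a)
    rw [norm_mul, norm_mul, norm_pow, hc, one_pow, one_mul, RCLike.norm_conj, ← sq] at h1
    exact h1.trans hi
  have heq : ‖s‖ = ‖a‖ ^ 2 := by
    rw [← sub_eq_zero, ← abs_eq_zero]
    refine le_antisymm (le_of_forall_pos_le_add fun ε hε => ?_) (abs_nonneg _)
    have := hclose (ε / 5) (by positivity)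
    linarith
  have hzero : ∫ x, ‖g x - a‖ ^ 2 ∂μ = 0 := by
    have h1 : ((∫ x, ‖g x - a‖ ^ 2 ∂μ : ℝ) : ℂ) = s - a * (starRingEnd ℂ) a := by
      rw [← integral_complex_ofReal]
      have h2 : ∀ x, ((‖g x - a‖ ^ 2 : ℝ) : ℂ) = (g x * (starRingEnd ℂ) (g x) -
          (starRingEnd ℂ) a * g x) - (a * (starRingEnd ℂ) (g x) - a * (starRingEnd ℂ) a) := by
        intro x
        rw [← Complex.normSq_eq_norm_sq, ← Complex.mul_conj, map_sub]
        ring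
      simp only [h2]
      refine (integral_sub (igg.sub (ig.const_mul _))
        ((igs.const_mul _).sub (integrable_const _))).trans ?_
      simp only [Pi.sub_apply]
      rw [integral_sub igg (ig.const_mul _), integral_sub (igs.const_mul _) (integrable_const _),
        integral_const_mul, integral_const_mul, hconj, integral_const]
      simp only [probReal_univ, one_smul]
      rw [← ha, ← hs]
      ring
    have h3 : s - a * (starRingEnd ℂ) a = 0 := by
      rw [Complex.mul_conj, Complex.normSq_eq_norm_sq, ← heq, hsn, hs', sub_self]
    rw [h3] at h1
    exact_mod_cast h1
  refine ⟨a, ?_⟩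
  have hint : Integrable (fun x => ‖g x - a‖ ^ 2) μ := by
    refine Integrable.of_bound ((hg.sub_const a).norm.pow_const 2).aestronglyMeasurable
      (C := (1 + ‖a‖) ^ 2) (ae_of_all _ fun x => ?_)
    rw [norm_pow, norm_norm]
    gcongr
    exact (norm_sub_le _ _).trans (by linarith [hg1 x])
  have := (integral_eq_zero_iff_of_nonneg (fun x => by positivity) hint).1 hzero
  filter_upwards [this] with x hx
  simpa [sub_eq_zero] using hx

theorem div_one_add_lt_div_one_add {a b : ℝ} (ha : 0 ≤ a) (h : a < b) : a / (1 + a) < b / (1 + b) := by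
  rw [div_lt_div_iff₀ (by linarith) (by linarith)]
  linarith

/-- A measure preserving map whose iterates along some sequence decorrelate all pairs of
continuous functions is weak mixing. -/
theorem isWeakMixing_of_correlation (μ : Measure X) [IsProbabilityMeasure μ] {f : X → X}
    (hf : MeasurePreserving f μ μ) {ι : Type*} {l : Filter ι} [l.NeBot] {m : ι → ℕ}
    (hmix : ∀ u v : C(X, ℂ),
      Tendsto (fun i => correlation μ (hf.iterate (m i)).measurable u v) l (𝓝 0)) :
    IsWeakMixing f μ := by
  refine ⟨hf, fun c h hh heig => ?_⟩
  -- The eigenfunction need not be integrable. A bounded strictly increasing function of `‖h‖` is,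
  -- and it still detects equality of moduli.
  set φ : ℝ → ℝ := fun s => s / (1 + s) with hφ
  have hφm : Measurable φ := by
    rw [hφ]
    fun_prop
  have hφ0 : ∀ s, 0 ≤ s → 0 ≤ φ s ∧ φ s ≤ 1 := by
    intro s hs
    exact ⟨by positivity, (div_le_one (by linarith)).2 (by linarith)⟩
  have hφi : ∀ r : ℝ, 0 ≤ r → Integrable (fun x => φ (r * ‖h x‖)) μ := by
    intro r hr
    refine Integrable.of_bound (hφm.comp (hh.norm.const_mul r)).aestronglyMeasurable (C := 1)
      (ae_of_all _ fun x => ?_)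
    have := hφ0 (r * ‖h x‖) (by positivity)
    rw [Real.norm_of_nonneg this.1]
    exact this.2
  have hinj : ∀ s t, 0 ≤ s → 0 ≤ t → φ s = φ t → s = t := by
    intro s t hs ht hst
    rcases lt_trichotomy s t with h1 | h1 | h1
    · exact absurd hst (div_one_add_lt_div_one_add hs h1).ne
    · exact h1
    · exact absurd hst (div_one_add_lt_div_one_add ht h1).ne'
  have hint : ∫ x, φ (‖c‖ * ‖h x‖) ∂μ = ∫ x, φ (1 * ‖h x‖) ∂μ := by
    have h1 : ∫ x, φ (1 * ‖h x‖) ∂μ = ∫ x, φ (1 * ‖h (f x)‖) ∂μ := by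
      conv_lhs => rw [← hf.map_eq]
      exact integral_map hf.measurable.aemeasurable
        (hφm.comp (hh.norm.const_mul 1)).aestronglyMeasurable
    rw [h1]
    apply integral_congr_ae
    filter_upwards [heig] with x hx
    rw [hx, norm_mul, one_mul]
  have hmono : ∀ r s : ℝ, 0 ≤ r → r ≤ s → ∀ x, φ (r * ‖h x‖) ≤ φ (s * ‖h x‖) := by
    intro r s hr hrs x
    rcases (mul_le_mul_of_nonneg_right hrs (norm_nonneg (h x))).lt_or_eq with h1 | h1
    · exact (div_one_add_lt_div_one_add (by positivity) h1).le
    · rw [h1]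
  -- By monotonicity one integrand dominates the other; the integrals agree by invariance, so the
  -- integrands agree almost everywhere.
  have hae : ∀ᵐ x ∂μ, ‖c‖ * ‖h x‖ = 1 * ‖h x‖ := by
    have h1 : (fun x => φ (‖c‖ * ‖h x‖)) =ᵐ[μ] fun x => φ (1 * ‖h x‖) := by
      rcases le_total ‖c‖ 1 with h1 | h1
      · exact (integral_eq_iff_of_ae_le (hφi _ (norm_nonneg _)) (hφi _ zero_le_one)
          (ae_of_all _ (hmono _ _ (norm_nonneg _) h1))).1 hint
      · exact ((integral_eq_iff_of_ae_le (hφi _ zero_le_one) (hφi _ (norm_nonneg _))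
          (ae_of_all _ (hmono _ _ zero_le_one h1))).1 hint.symm).symm
    filter_upwards [h1] with x hx
    exact hinj _ _ (by positivity) (by positivity) hx
  by_cases hc : ‖c‖ = 1
  · have hpos : ∀ x, (0 : ℝ) < 1 + ‖h x‖ := fun x => by positivity
    obtain ⟨a, ha⟩ := ae_const_of_bounded_eigenfunction μ hf hmix hc
      (g := fun x => h x / ((1 + ‖h x‖ : ℝ) : ℂ))
      (hh.div (Complex.measurable_ofReal.comp (hh.norm.const_add 1)))
      (fun x => by
        rw [norm_div, Complex.norm_real, Real.norm_of_nonneg (hpos x).le]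
        exact (hφ0 _ (norm_nonneg _)).2)
      (by
        filter_upwards [heig] with x hx
        rw [hx, norm_mul, hc, one_mul, mul_div_assoc])
    -- This inverts `w ↦ w / (1 + ‖w‖)`, the normalization that made the eigenfunction bounded.
    refine ⟨a / ((1 - ‖a‖ : ℝ) : ℂ), ?_⟩
    filter_upwards [ha] with x hx
    have h1 : 1 - ‖a‖ = (1 + ‖h x‖)⁻¹ := by
      rw [← hx, norm_div, Complex.norm_real, Real.norm_of_nonneg (hpos x).le]
      have := (hpos x).ne'
      field_simp
      ring
    rw [h1, ← hx]
    have : ((1 + ‖h x‖ : ℝ) : ℂ) ≠ 0 := by exact_mod_cast (hpos x).ne'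
    push_cast at this ⊢
    field_simp
  · refine ⟨0, ?_⟩
    filter_upwards [hae] with x hx
    have : (‖c‖ - 1) * ‖h x‖ = 0 := by linarith
    rcases mul_eq_zero.1 this with h1 | h1
    · exact absurd (by linarith) hc
    · exact norm_eq_zero.1 h1

end Criterion

/-! ### Holomorphic lifts on a strip -/

/-- `C` is a holomorphic lift of `F` to the strip of width `ρ` commuting with the deck
transformations and at bounded distance from the identity. -/
structure IsStripLift (ρ : ℝ) (F : Torus → Torus) (C : ℂ × ℂ → ℂ × ℂ) : Prop where
  holomorphic : DifferentiableOn ℂ C (strip ρ)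
  real : ∀ x : ℝ × ℝ, ∃ y : ℝ × ℝ, C (toC x) = toC y ∧ proj y = F (proj x)
  add_int : ∀ z ∈ strip ρ, ∀ v, C (z + intC v) = C z + intC v
  bounded : ∃ B, ∀ z ∈ strip ρ, ‖C z - z‖ ≤ B

/-- The displacement on the real plane of a lift. -/
def realDisp (C : ℂ × ℂ → ℂ × ℂ) (x : ℝ × ℝ) : ℝ × ℝ :=
  ((C (toC x)).1.re - x.1, (C (toC x)).2.re - x.2)

theorem IsStripLift.toC_add_realDisp {ρ : ℝ} {F : Torus → Torus} {C : ℂ × ℂ → ℂ × ℂ}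
    (h : IsStripLift ρ F C) (x : ℝ × ℝ) : toC (x + realDisp C x) = C (toC x) := by
  obtain ⟨y, hy, -⟩ := h.real x
  rw [hy]
  simp only [realDisp, hy]
  simp [toC]

theorem IsStripLift.isDisplacement {ρ : ℝ} (hρ : 0 < ρ) {F : Torus → Torus}
    {C : ℂ × ℂ → ℂ × ℂ} (h : IsStripLift ρ F C) : IsDisplacement F (realDisp C) where
  continuous := by
    have hc : Continuous fun x => C (toC x) :=
      h.holomorphic.continuousOn.comp_continuous continuous_toC (toC_mem_strip hρ)
    exact ((Complex.continuous_re.comp (continuous_fst.comp hc)).sub continuous_fst).prodMk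
      ((Complex.continuous_re.comp (continuous_snd.comp hc)).sub continuous_snd)
  periodic x a b := by
    have h1 : toC (x + ((a : ℝ), (b : ℝ))) = toC x + intC (a, b) := by
      simp [toC, intC]
    simp only [realDisp, h1, h.add_int _ (toC_mem_strip hρ x)]
    simp [intC]
  covers x := by
    obtain ⟨y, hy, hy'⟩ := h.real x
    have := h.toC_add_realDisp x
    rw [hy] at this
    rw [toC_injective this, hy']

theorem IsStripLift.isHolExtension {ρ : ℝ} {F : Torus → Torus} {C : ℂ × ℂ → ℂ × ℂ}
    (h : IsStripLift ρ F C) :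
    IsHolExtension ρ (fun x => (realDisp C x).1) (fun z => (C z - z).1) ∧
      IsHolExtension ρ (fun x => (realDisp C x).2) (fun z => (C z - z).2) := by
  have hd : DifferentiableOn ℂ (fun z => C z - z) (strip ρ) :=
    h.holomorphic.sub differentiableOn_id
  have hx : ∀ x, C (toC x) - toC x = toC (realDisp C x) := by
    intro x
    rw [← h.toC_add_realDisp x]
    simp [toC]
  exact ⟨⟨hd.fst, fun x => congrArg Prod.fst (hx x)⟩, ⟨hd.snd, fun x => congrArg Prod.snd (hx x)⟩⟩

theorem rhoNorm_le {ρ B : ℝ} {u : ℝ × ℝ → ℝ} {U : ℂ × ℂ → ℂ} (h : IsHolExtension ρ u U)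
    (hB : ∀ z ∈ strip ρ, ‖U z‖ ≤ B) : rhoNorm ρ u ≤ ENNReal.ofReal B := by
  refine iInf₂_le_of_le U h (iSup₂_le fun z hz => ?_)
  rw [← ofReal_norm]
  exact ENNReal.ofReal_le_ofReal (hB z hz)

/-- Osgood's lemma makes `U` complex analytic, and `u` is the real part of its restriction to the
real plane. -/
theorem IsHolExtension.analyticOnNhd {ρ : ℝ} (hρ : 0 < ρ) {u : ℝ × ℝ → ℝ} {U : ℂ × ℂ → ℂ}
    (h : IsHolExtension ρ u U) : AnalyticOnNhd ℝ u Set.univ := by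
  intro x _
  have hs := isOpen_strip ρ
  have hU : AnalyticOnNhd ℂ U (strip ρ) := by
    refine analyticOnNhd_of_separately_differentiable hs h.holomorphic.continuousOn ?_ ?_
    · intro z hz
      exact DifferentiableAt.comp z.1 (f := fun t => (t, z.2))
        (h.holomorphic.differentiableAt (hs.mem_nhds hz)) (by fun_prop)
    · intro z hz
      exact DifferentiableAt.comp z.2 (f := fun t => (z.1, t))
        (h.holomorphic.differentiableAt (hs.mem_nhds hz)) (by fun_prop)
  have h1 : AnalyticAt ℝ U (toC x) := (hU _ (toC_mem_strip hρ x)).restrictScalars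
  have h2 : AnalyticAt ℝ toC x :=
    ((Complex.ofRealCLM.comp (ContinuousLinearMap.fst ℝ ℝ ℝ)).prod
      (Complex.ofRealCLM.comp (ContinuousLinearMap.snd ℝ ℝ ℝ))).analyticAt x
  have h3 : AnalyticAt ℝ (fun y => Complex.reCLM (U (toC y))) x :=
    (Complex.reCLM.analyticAt _).comp (h1.comp h2)
  have h4 : (fun y => Complex.reCLM (U (toC y))) = u := by
    ext1 y
    exact (congrArg Complex.re (h.extends_real y)).trans (Complex.ofReal_re _)
  rwa [h4] at h3

theorem IsStripLift.analyticOnNhd {ρ : ℝ} (hρ : 0 < ρ) {F : Torus → Torus} {C : ℂ × ℂ → ℂ × ℂ}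
    (h : IsStripLift ρ F C) : AnalyticOnNhd ℝ (realDisp C) Set.univ :=
  (h.isHolExtension.1.analyticOnNhd hρ).prod (h.isHolExtension.2.analyticOnNhd hρ)

theorem isRhoDiffeo_of_isStripLift {ρ : ℝ} (hρ : 0 < ρ) {F : Equiv.Perm Torus}
    {C C' : ℂ × ℂ → ℂ × ℂ} (h : IsStripLift ρ F C) (h' : IsStripLift ρ F.symm C') :
    IsRhoDiffeo ρ F := by
  obtain ⟨B, hB⟩ := h.bounded
  refine ⟨⟨⟨_, h.isDisplacement hρ, h.analyticOnNhd hρ⟩,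
    ⟨_, h'.isDisplacement hρ, h'.analyticOnNhd hρ⟩⟩, _, h.isDisplacement hρ, ?_, ?_⟩
  · exact (rhoNorm_le h.isHolExtension.1 fun z hz =>
      (norm_fst_le (C z - z)).trans (hB z hz)).trans_lt ENNReal.ofReal_lt_top
  · exact (rhoNorm_le h.isHolExtension.2 fun z hz =>
      (norm_snd_le (C z - z)).trans (hB z hz)).trans_lt ENNReal.ofReal_lt_top

theorem IsHolExtension.sub {ρ : ℝ} {u v : ℝ × ℝ → ℝ} {U V : ℂ × ℂ → ℂ}
    (hu : IsHolExtension ρ u U) (hv : IsHolExtension ρ v V) :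
    IsHolExtension ρ (fun x => u x - v x) (fun z => U z - V z) :=
  ⟨hu.holomorphic.sub hv.holomorphic, fun x => by
    rw [hu.extends_real, hv.extends_real, Complex.ofReal_sub]⟩

theorem rhoDist_le {ρ : ℝ} (hρ : 0 < ρ) {F G : Equiv.Perm Torus} {C D : ℂ × ℂ → ℂ × ℂ}
    (hF : IsStripLift ρ F C) (hG : IsStripLift ρ G D) {ε : ℝ}
    (h : ∀ z ∈ strip ρ, ‖C z - D z‖ ≤ ε) : rhoDist ρ F G ≤ ENNReal.ofReal ε := by
  refine iInf_le_of_le (realDisp C) <| iInf_le_of_le (realDisp D) <|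
    iInf₂_le_of_le (hF.isDisplacement hρ) (hG.isDisplacement hρ) (max_le ?_ ?_)
  · refine iInf_le_of_le 0 ?_
    simp only [Int.cast_zero, add_zero]
    refine rhoNorm_le (hF.isHolExtension.1.sub hG.isHolExtension.1) fun z hz => ?_
    have : (C z - z).1 - (D z - z).1 = (C z - D z).1 := by simp
    rw [this]
    exact (norm_fst_le _).trans (h z hz)
  · refine iInf_le_of_le 0 ?_
    simp only [Int.cast_zero, add_zero]
    refine rhoNorm_le (hF.isHolExtension.2.sub hG.isHolExtension.2) fun z hz => ?_
    have : (C z - z).2 - (D z - z).2 = (C z - D z).2 := by simp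
    rw [this]
    exact (norm_snd_le _).trans (h z hz)

theorem IsStripLift.dist_le {ρ : ℝ} (hρ : 0 < ρ) {F G : Torus → Torus} {C D : ℂ × ℂ → ℂ × ℂ}
    (hF : IsStripLift ρ F C) (hG : IsStripLift ρ G D) {ε : ℝ}
    (h : ∀ z ∈ strip ρ, ‖C z - D z‖ ≤ ε) (y : Torus) : dist (F y) (G y) ≤ ε := by
  obtain ⟨x, rfl⟩ := proj_surjective y
  obtain ⟨a, ha, ha'⟩ := hF.real x
  obtain ⟨b, hb, hb'⟩ := hG.real x
  rw [← ha', ← hb']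
  refine (dist_proj_le a b).trans ?_
  rw [← norm_toC_sub, ← ha, ← hb]
  exact h _ (toC_mem_strip hρ x)

theorem isStripLift_conj {H : Equiv.Perm Torus} {C : Equiv.Perm (ℂ × ℂ)} (h : IsLift H C)
    (h' : IsLift H.symm C.symm) (t : ℝ) {ρ : ℝ} (hρ : 0 < ρ) :
    IsStripLift ρ (H * rot t * H⁻¹ : Equiv.Perm Torus)
      (C * rotC t * C⁻¹ : Equiv.Perm (ℂ × ℂ)) where
  holomorphic := (isLift_conj h h' t).differentiable.differentiableOn
  real := (isLift_conj h h' t).real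
  add_int z _ v := conj_add_intC h h' t z v
  bounded := by
    obtain ⟨K, hK, hl⟩ := (isLift_conj h h' t).lipschitz ρ hρ
    have hadd := conj_add_intC h h' t
    set D : ℂ × ℂ → ℂ × ℂ := ⇑(C * rotC t * C⁻¹ : Equiv.Perm (ℂ × ℂ))
    refine ⟨K * (1 + ρ) + ‖D (toC 0)‖ + (1 + ρ), fun z hz => ?_⟩
    -- The displacement is `ℤ²`-periodic, so it is enough to bound it for real parts in `[0, 1)`,
    -- where the Lipschitz estimate from the origin applies.
    set v : ℤ × ℤ := (⌊z.1.re⌋, ⌊z.2.re⌋) with hv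
    set w : ℂ × ℂ := z + intC (-v) with hw
    have hzw : z = w + intC v := by
      rw [hw]
      ext1 <;> simp [intC]
    have hws : w ∈ strip ρ := add_intC_mem_strip hz _
    have hwn : ‖w‖ ≤ 1 + ρ := by
      have aux : ∀ c : ℂ, |c.im| < ρ → ‖c + ((-⌊c.re⌋ : ℤ) : ℂ)‖ ≤ 1 + ρ := by
        intro c hc
        refine (Complex.norm_le_abs_re_add_abs_im _).trans ?_
        have h1 : (c + ((-⌊c.re⌋ : ℤ) : ℂ)).re = Int.fract c.re := by
          simp [Int.fract, sub_eq_add_neg]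
        have h2 : (c + ((-⌊c.re⌋ : ℤ) : ℂ)).im = c.im := by simp
        rw [h1, h2, Int.abs_fract]
        linarith [Int.fract_lt_one c.re]
      rw [Prod.norm_def]
      exact max_le (aux z.1 hz.1) (aux z.2 hz.2)
    have h1 : D z - z = D w - w := by
      rw [hzw, hadd]
      abel
    rw [h1]
    have h2 : ‖D w - D (toC 0)‖ ≤ K * (1 + ρ) := by
      refine (hl w hws _ (toC_mem_strip hρ 0)).trans ?_
      have : w - toC 0 = w := by
        ext1 <;> simp [toC]
      rw [this]
      gcongr
    have h3 : D w - w = (D w - D (toC 0)) + D (toC 0) - w := by abel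
    rw [h3]
    refine (norm_sub_le _ _).trans ?_
    linarith [norm_add_le (D w - D (toC 0)) (D (toC 0))]

/-! ### Limits of lifts -/

/-- The one-variable Weierstrass theorem on each slice makes the limit separately holomorphic; it is
continuous as a uniform limit, so Osgood's lemma applies. -/
theorem differentiableOn_of_tendstoUniformlyOn {U : ℕ → ℂ × ℂ → ℂ} {V : ℂ × ℂ → ℂ}
    {s : Set (ℂ × ℂ)} (hs : IsOpen s) (hU : ∀ n, DifferentiableOn ℂ (U n) s)
    (h : TendstoUniformlyOn U V atTop s) : DifferentiableOn ℂ V s := by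
  have hc : ContinuousOn V s :=
    h.continuousOn (Eventually.of_forall fun n => (hU n).continuousOn).frequently
  have aux : ∀ (e : ℂ → ℂ × ℂ), Differentiable ℂ e → ∀ t, e t ∈ s →
      DifferentiableAt ℂ (fun t => V (e t)) t := by
    intro e he t ht
    have ho : IsOpen (e ⁻¹' s) := hs.preimage he.continuous
    have h1 : TendstoUniformlyOn (fun n t => U n (e t)) (fun t => V (e t)) atTop (e ⁻¹' s) :=
      h.comp e
    refine (h1.tendstoLocallyUniformlyOn.differentiableOn (Eventually.of_forall fun n => ?_)
      ho).differentiableAt (ho.mem_nhds ht)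
    exact (hU n).comp he.differentiableOn (Set.mapsTo_preimage _ _)
  exact (analyticOnNhd_of_separately_differentiable hs hc
    (fun z hz => aux (fun t => (t, z.2)) (by fun_prop) z.1 hz)
    (fun z hz => aux (fun t => (z.1, t)) (by fun_prop) z.2 hz)).differentiableOn

/-- Geometric increments give a uniform limit, and being real on real points, covering the map and
commuting with `ℤ²` are closed conditions. -/
theorem exists_isStripLift_limit {ρ : ℝ} (hρ : 0 < ρ) {F : ℕ → Torus → Torus}
    {C : ℕ → ℂ × ℂ → ℂ × ℂ} (h : ∀ n, IsStripLift ρ (F n) (C n))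
    (hC : ∀ n, ∀ z ∈ strip ρ, ‖C (n + 1) z - C n z‖ ≤ (1 / 2 : ℝ) ^ (n + 1))
    {f : Torus → Torus} (hf : ∀ y, Tendsto (fun n => F n y) atTop (𝓝 (f y))) :
    ∃ D, IsStripLift ρ f D ∧ ∀ n, ∀ z ∈ strip ρ, ‖C n z - D z‖ ≤ (1 / 2 : ℝ) ^ n := by
  have hdist : ∀ z ∈ strip ρ, ∀ n, dist (C n z) (C (n + 1) z) ≤ 1 / 2 * (1 / 2 : ℝ) ^ n := by
    intro z hz n
    rw [dist_comm, dist_eq_norm, ← pow_succ']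
    exact hC n z hz
  have hex : ∀ z ∈ strip ρ, ∃ w, Tendsto (fun n => C n z) atTop (𝓝 w) := fun z hz =>
    cauchySeq_tendsto_of_complete (cauchySeq_of_le_geometric _ _ (by norm_num) (hdist z hz))
  choose! D hD using hex
  have hclose : ∀ n, ∀ z ∈ strip ρ, ‖C n z - D z‖ ≤ (1 / 2 : ℝ) ^ n := by
    intro n z hz
    have := dist_le_of_le_geometric_of_tendsto _ _ (by norm_num) (hdist z hz) (hD z hz) n
    rw [dist_eq_norm] at this
    refine this.trans (le_of_eq ?_)
    ring
  have hpow : Tendsto (fun n : ℕ => (1 / 2 : ℝ) ^ n) atTop (𝓝 0) :=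
    tendsto_pow_atTop_nhds_zero_of_lt_one (by norm_num) (by norm_num)
  have hunif : TendstoUniformlyOn C D atTop (strip ρ) := by
    rw [Metric.tendstoUniformlyOn_iff]
    intro ε hε
    filter_upwards [hpow.eventually (gt_mem_nhds hε)] with n hn z hz
    rw [dist_comm, dist_eq_norm]
    exact (hclose n z hz).trans_lt hn
  refine ⟨D, ⟨?_, ?_, ?_, ?_⟩, hclose⟩
  · have h1 : DifferentiableOn ℂ (fun z => (D z).1) (strip ρ) :=
      differentiableOn_of_tendstoUniformlyOn (isOpen_strip ρ) (fun n => (h n).holomorphic.fst)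
        (uniformContinuous_fst.comp_tendstoUniformlyOn hunif)
    have h2 : DifferentiableOn ℂ (fun z => (D z).2) (strip ρ) :=
      differentiableOn_of_tendstoUniformlyOn (isOpen_strip ρ) (fun n => (h n).holomorphic.snd)
        (uniformContinuous_snd.comp_tendstoUniformlyOn hunif)
    exact h1.prodMk h2
  · intro x
    have hx := hD _ (toC_mem_strip hρ x)
    choose y hy hy' using fun n => (h n).real x
    have hre : Continuous fun z : ℂ × ℂ => (z.1.re, z.2.re) := by fun_prop
    have h1 : Tendsto y atTop (𝓝 ((D (toC x)).1.re, (D (toC x)).2.re)) := by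
      refine ((hre.tendsto _).comp hx).congr fun n => ?_
      simp only [Function.comp_apply, hy]
      simp [toC]
    refine ⟨((D (toC x)).1.re, (D (toC x)).2.re), ?_, ?_⟩
    · refine tendsto_nhds_unique hx (((continuous_toC.tendsto _).comp h1).congr fun n => ?_)
      exact (hy n).symm
    · exact tendsto_nhds_unique ((continuous_proj.tendsto _).comp h1)
        ((hf (proj x)).congr fun n => (hy' n).symm)
  · intro z hz v
    refine tendsto_nhds_unique (hD _ (add_intC_mem_strip hz v)) ?_
    refine ((hD z hz).add_const (intC v)).congr fun n => ?_
    exact ((h n).add_int z hz v).symm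
  · obtain ⟨B, hB⟩ := (h 0).bounded
    refine ⟨1 + B, fun z hz => ?_⟩
    have h1 := hclose 0 z hz
    have h2 : D z - z = -(C 0 z - D z) + (C 0 z - z) := by abel
    rw [h2]
    refine (norm_add_le _ _).trans ?_
    rw [norm_neg]
    exact add_le_add (by simpa using h1) (hB z hz)

/-- A finite Borel measure is determined by its integrals of bounded continuous functions, and these
pass to the limit by dominated convergence. -/
theorem measurePreserving_of_tendsto {X : Type*} [PseudoMetricSpace X] [MeasurableSpace X]
    [BorelSpace X] {μ : Measure X} [IsProbabilityMeasure μ] {F : ℕ → X → X} {f : X → X}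
    (hF : ∀ n, MeasurePreserving (F n) μ μ) (hf : Measurable f)
    (h : ∀ y, Tendsto (fun n => F n y) atTop (𝓝 (f y))) : MeasurePreserving f μ μ := by
  refine ⟨hf, ?_⟩
  have : IsProbabilityMeasure (μ.map f) := Measure.isProbabilityMeasure_map hf.aemeasurable
  refine ext_of_forall_integral_eq_of_IsFiniteMeasure fun u => ?_
  rw [integral_map hf.aemeasurable u.continuous.measurable.aestronglyMeasurable]
  have h1 : Tendsto (fun n => ∫ x, u (F n x) ∂μ) atTop (𝓝 (∫ x, u (f x) ∂μ)) := by
    refine tendsto_integral_of_dominated_convergence (fun _ => ‖u‖) (fun n => ?_)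
      (integrable_const _) (fun n => ae_of_all _ fun x => u.norm_coe_le_norm _)
      (ae_of_all _ fun x => (u.continuous.tendsto _).comp (h x))
    exact (u.continuous.measurable.comp (hF n).measurable).aestronglyMeasurable
  have h2 : ∀ n, ∫ x, u (F n x) ∂μ = ∫ x, u x ∂μ := by
    intro n
    conv_rhs => rw [← (hF n).map_eq]
    rw [integral_map (hF n).measurable.aemeasurable
      u.continuous.measurable.aestronglyMeasurable]
  simp only [h2] at h1
  exact (tendsto_nhds_unique h1 tendsto_const_nhds)

/-! ### The choice of the subsequence -/

/-- The condition on the next term depends on the whole history through `H_n`. The recursion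
therefore carries a full sequence, of which stage `n` freezes the entries up to `n`; `hloc` lets the
diagonal replace it. -/
theorem exists_dependent_seq {Cond : ℕ → (ℕ → ℕ) → ℕ → Prop}
    (hloc : ∀ n k k' j, (∀ i ≤ n, k i = k' i) → Cond n k j → Cond n k' j)
    (hex : ∀ n k, ∃ j, Cond n k j) : ∃ k : ℕ → ℕ, ∀ n, Cond n k (k (n + 1)) := by
  choose c hc using hex
  let K : ℕ → ℕ → ℕ := fun n => Nat.rec (fun _ => 0) (fun n k => Function.update k (n + 1) (c n k)) n
  have hK : ∀ n, K (n + 1) = Function.update (K n) (n + 1) (c n (K n)) := fun n => rfl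
  have hstab : ∀ n i, i ≤ n → K n i = K i i := by
    intro n
    induction n with
    | zero =>
      intro i hi
      rw [Nat.le_zero.1 hi]
    | succ n ih =>
      intro i hi
      rcases hi.eq_or_lt with rfl | h
      · rfl
      · rw [hK, Function.update_of_ne h.ne, ih i (Nat.lt_succ_iff.1 h)]
  refine ⟨fun n => K n n, fun n => hloc n (K n) _ _ (fun i hi => hstab n i hi) ?_⟩
  have : K (n + 1) (n + 1) = c n (K n) := by rw [hK, Function.update_self]
  change Cond n (K n) (K (n + 1) (n + 1))
  rw [this]
  exact hc n (K n)

theorem HMap_congr (σ : ℝ) {q q' : ℕ → ℕ} {n : ℕ} (h : ∀ i ≤ n, q i = q' i) :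
    HMap σ q n = HMap σ q' n ∧ HMapC σ q n = HMapC σ q' n := by
  induction n with
  | zero => exact ⟨rfl, rfl⟩
  | succ n ih =>
    have ih' := ih fun i hi => h i (hi.trans n.le_succ)
    simp only [HMap, HMapC, hMap, hMapC, ih'.1, ih'.2, h (n + 1) le_rfl, and_self]

/-- The requirements on the next index `j` of the subsequence, given the current index `i`, its
position `n` and the conjugacy `H` (with complexification `C`) built so far. -/
structure Admissible (α δ σ ρ : ℝ) (P : ℕ → ℤ) (Q : ℕ → ℕ) (n : ℕ) (H : Equiv.Perm Torus)
    (C : Equiv.Perm (ℂ × ℂ)) (i j : ℕ) : Prop where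
  lt : i < j
  denom_lt : Q i < Q j
  closer : |α - (P j : ℝ) / Q j| < |α - (P i : ℝ) / Q i|
  -- Here `x` stands for the fraction after the next one, which is not chosen yet; hence the
  -- quantifier.
  perturb : ∀ x : ℝ, |x - (P j : ℝ) / Q j| ≤ 2 * Real.exp (-(Q j : ℝ) ^ (1 + δ)) →
    ∀ m : ℤ, |m| ≤ Q j → ∀ z ∈ strip ρ,
      ‖((C * (shearC ⌊((n + 1 : ℕ) : ℝ) * (Q j : ℝ) ^ σ⌋ * phiC (Q j))) * rotC (m * x) *
          (C * (shearC ⌊((n + 1 : ℕ) : ℝ) * (Q j : ℝ) ^ σ⌋ * phiC (Q j)))⁻¹ :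
            Equiv.Perm (ℂ × ℂ)) z -
        (C * rotC (m * ((P j : ℝ) / Q j)) * C⁻¹ : Equiv.Perm (ℂ × ℂ)) z‖ ≤ (1 / 2 : ℝ) ^ (n + 1)
  approx : ∃ m : ℕ, m ≤ Q j ∧ ∀ x, dist ((H * rot (m * ((P j : ℝ) / Q j)) * H⁻¹ :
      Equiv.Perm Torus) x) ((H * rot (1 / (2 * Q i)) * H⁻¹ : Equiv.Perm Torus) x) ≤
    (1 / 2 : ℝ) ^ n
  -- Only finitely many test pairs are treated at each stage, yet every pair from the dense sequence
  -- is treated from some stage on.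
  mixing : ∀ a ≤ n, ∀ b ≤ n,
    ‖(∫ x, TopologicalSpace.denseSeq C(Torus, ℂ) a
        ((H * halfShift ⌊((n + 1 : ℕ) : ℝ) * (Q j : ℝ) ^ σ⌋ (Q j) * H⁻¹ : Equiv.Perm Torus) x) *
        TopologicalSpace.denseSeq C(Torus, ℂ) b x) -
      (∫ x, TopologicalSpace.denseSeq C(Torus, ℂ) a x) *
        ∫ x, TopologicalSpace.denseSeq C(Torus, ℂ) b x‖ ≤ (1 / 2 : ℝ) ^ n

/-! ### Arithmetic of the approximations and existence of admissible indices -/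

section Liouville

variable {α δ : ℝ} {P : ℕ → ℤ} {Q : ℕ → ℕ}

/-- Bounded denominators and bounded distance to `α` leave only finitely many pairs, and the
solutions are distinct. -/
theorem tendsto_denominators (hdistinct : Function.Injective fun j => (P j, Q j))
    (hsol : ∀ j, 0 < Q j ∧ |α - (P j : ℝ) / Q j| < 1) : Tendsto Q atTop atTop := by
  rw [tendsto_atTop]
  intro B
  obtain ⟨M, hM⟩ := exists_nat_ge ((|α| + 1) * B)
  have hfin : {j | Q j < B}.Finite := by
    refine ((((Set.finite_Icc (-(M : ℤ)) M).prod (Set.finite_Iio B))).preimage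
      hdistinct.injOn).subset ?_
    intro j hj
    have hj' : Q j < B := hj
    obtain ⟨h0, h1⟩ := hsol j
    have hq : (0 : ℝ) < Q j := by exact_mod_cast h0
    have h2 : |(P j : ℝ) / Q j| < |α| + 1 := by
      have := abs_sub_abs_le_abs_sub ((P j : ℝ) / Q j) α
      rw [abs_sub_comm] at this
      linarith
    rw [abs_div, abs_of_pos hq, div_lt_iff₀ hq] at h2
    have h3 : |(P j : ℝ)| ≤ M := by
      refine (h2.le.trans ?_).trans hM
      have : (Q j : ℝ) ≤ B := by exact_mod_cast hj'.le
      gcongr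
    have h4 : |P j| ≤ (M : ℤ) := by exact_mod_cast h3
    exact ⟨abs_le.1 h4, hj'⟩
  have := hfin.eventually_cofinite_notMem
  rw [Nat.cofinite_eq_atTop] at this
  filter_upwards [this] with j hj
  exact not_lt.1 hj

theorem exp_neg_rpow_le (hδ : 0 < δ) {q : ℕ} (hq : 0 < q) :
    Real.exp (-((q : ℝ) ^ (1 + δ))) ≤ Real.exp (-(q : ℝ)) := by
  apply Real.exp_le_exp.2
  have h1 : (1 : ℝ) ≤ q := by exact_mod_cast hq
  have := Real.rpow_le_rpow_of_exponent_le h1 (show (1 : ℝ) ≤ 1 + δ by linarith)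
  rw [Real.rpow_one] at this
  linarith

/-- If `α` were one of the fractions, any reduced fraction of larger denominator `Q j` would be at
distance at least `1 / (Q i * Q j)`, against the exponential bound. This allows the errors to
decrease strictly. -/
theorem ne_convergent (hδ : 0 < δ) (hQ : Tendsto Q atTop atTop)
    (hsol : ∀ j, 0 < Q j ∧ IsCoprime (P j) (Q j : ℤ) ∧
      |α - (P j : ℝ) / (Q j : ℝ)| < Real.exp (-((Q j : ℝ) ^ (1 + δ)))) (i : ℕ) :
    α ≠ (P i : ℝ) / Q i := by
  intro hα
  have hb : (0 : ℝ) < Q i := by exact_mod_cast (hsol i).1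
  have hlim := (Real.tendsto_pow_mul_exp_neg_atTop_nhds_zero 1).comp
    (tendsto_natCast_atTop_atTop.comp hQ)
  obtain ⟨j, hj1, hj2⟩ := ((hlim.eventually (gt_mem_nhds (show (0 : ℝ) < 1 / Q i by positivity))).and
    (hQ.eventually_gt_atTop (Q i))).exists
  obtain ⟨h0, hco, hlt⟩ := hsol j
  have hq : (0 : ℝ) < Q j := by exact_mod_cast h0
  have hlt' := hlt.trans_le (exp_neg_rpow_le hδ h0)
  simp only [Function.comp_apply, pow_one] at hj1
  have hne : P i * Q j - P j * Q i ≠ 0 := by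
    intro h
    have h1 : (Q j : ℤ) ∣ P j * Q i := ⟨P i, by linarith⟩
    have h2 : (Q j : ℤ) ∣ Q i := hco.symm.dvd_of_dvd_mul_left h1
    have h3 := Nat.le_of_dvd (hsol i).1 (by exact_mod_cast h2)
    omega
  have h4 : (1 : ℝ) ≤ |(P i : ℝ) * Q j - P j * Q i| := by
    exact_mod_cast Int.one_le_abs hne
  have h5 : |α - (P j : ℝ) / Q j| = |(P i : ℝ) * Q j - P j * Q i| / (Q i * Q j) := by
    rw [hα, div_sub_div _ _ hb.ne' hq.ne', abs_div, abs_of_pos (mul_pos hb hq),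
      mul_comm (Q i : ℝ) (P j : ℝ)]
  rw [h5, div_lt_iff₀ (by positivity)] at hlt'
  rw [lt_div_iff₀ hb] at hj1
  nlinarith

theorem exists_admissible {σ ρ : ℝ} (hδ : 0 < δ) (hσ : 0 < σ) (hσδ : σ < min (δ / 3) 1)
    (hρ : 0 < ρ) (hQ : Tendsto Q atTop atTop)
    (hsol : ∀ j, 0 < Q j ∧ IsCoprime (P j) (Q j : ℤ) ∧
      |α - (P j : ℝ) / (Q j : ℝ)| < Real.exp (-((Q j : ℝ) ^ (1 + δ)))) (n : ℕ) (q : ℕ → ℕ)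
    (i : ℕ) : ∃ j, Admissible α δ σ ρ P Q n (HMap σ q n) (HMapC σ q n) i j := by
  rw [lt_min_iff] at hσδ
  have hpos : (0 : ℝ) < (1 / 2 : ℝ) ^ n := by positivity
  have hH := isMeasHomeo_HMap σ q n
  have e1 : ∀ᶠ j in atTop, |α - (P j : ℝ) / Q j| < |α - (P i : ℝ) / Q i| := by
    have h1 : 0 < |α - (P i : ℝ) / Q i| :=
      abs_pos.2 (sub_ne_zero.2 (ne_convergent hδ hQ hsol i))
    have hlim := Real.tendsto_exp_neg_atTop_nhds_zero.comp
      (tendsto_natCast_atTop_atTop.comp hQ)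
    filter_upwards [hlim.eventually (gt_mem_nhds h1)] with j hj
    exact ((hsol j).2.2.trans_le (exp_neg_rpow_le hδ (hsol j).1)).trans hj
  have e2 := hQ.eventually (eventually_perturbation (δ := δ) hσ (by linarith) hσδ.2.le hρ
    (isLift_HMap σ q n).1 (isLift_HMap σ q n).2 (n + 1)
    (show (0 : ℝ) < (1 / 2 : ℝ) ^ (n + 1) by positivity))
  have e3 := hQ.eventually (eventually_exists_conj_rot_approx hH.continuous (1 / (2 * Q i)) hpos)
  have hb : Tendsto (fun q : ℕ => ⌊((n + 1 : ℕ) : ℝ) * (q : ℝ) ^ σ⌋) atTop atTop :=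
    tendsto_floor_atTop.comp (Tendsto.const_mul_atTop (by positivity)
      ((tendsto_rpow_atTop hσ).comp tendsto_natCast_atTop_atTop))
  have e4 : ∀ᶠ j in atTop, ∀ a ≤ n, ∀ b ≤ n,
    ‖(∫ x, TopologicalSpace.denseSeq C(Torus, ℂ) a
        ((HMap σ q n * halfShift ⌊((n + 1 : ℕ) : ℝ) * (Q j : ℝ) ^ σ⌋ (Q j) * (HMap σ q n)⁻¹ :
          Equiv.Perm Torus) x) * TopologicalSpace.denseSeq C(Torus, ℂ) b x) -
      (∫ x, TopologicalSpace.denseSeq C(Torus, ℂ) a x) *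
        ∫ x, TopologicalSpace.denseSeq C(Torus, ℂ) b x‖ ≤ (1 / 2 : ℝ) ^ n := by
    refine (Set.finite_Iic n).eventually_all.2 fun a _ =>
      (Set.finite_Iic n).eventually_all.2 fun b _ => ?_
    have h1 := (tendsto_correlation_conj_halfShift hb hH
      (TopologicalSpace.denseSeq C(Torus, ℂ) a) (TopologicalSpace.denseSeq C(Torus, ℂ) b)).comp hQ
    filter_upwards [(Metric.tendsto_nhds.1 h1) _ hpos] with j hj
    rw [dist_zero_right] at hj
    exact hj.le
  obtain ⟨j, h0, h1, h2, h3, h4, h5⟩ := ((eventually_gt_atTop i).and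
    ((hQ.eventually_gt_atTop (Q i)).and (e1.and (e2.and (e3.and e4))))).exists
  exact ⟨j, h0, h1, h2, h3 (P j), h4 (P j) (hsol j).2.1, h5⟩

end Liouville

/-! ### The limit diffeomorphism and its iterates -/

theorem dist_le_half_pow_of_tendsto {X : Type*} [PseudoMetricSpace X] {u : ℕ → X} {a : X} {N : ℕ}
    (h : ∀ n ≥ N, dist (u (n + 1)) (u n) ≤ (1 / 2 : ℝ) ^ (n + 1))
    (hu : Tendsto u atTop (𝓝 a)) : dist (u N) a ≤ (1 / 2 : ℝ) ^ N := by
  have h1 : ∀ i, dist (u (N + i)) (u (N + (i + 1))) ≤ (1 / 2 : ℝ) ^ (N + 1) * (1 / 2 : ℝ) ^ i := by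
    intro i
    rw [dist_comm]
    refine (h (N + i) (Nat.le_add_right _ _)).trans (le_of_eq ?_)
    ring
  have h2 : Tendsto (fun i => u (N + i)) atTop (𝓝 a) := by
    simpa only [add_comm N] using (tendsto_add_atTop_iff_nat N).2 hu
  refine (dist_le_of_le_geometric_of_tendsto₀ _ _ (by norm_num) h1 h2).trans (le_of_eq ?_)
  ring

theorem tendsto_half_pow : Tendsto (fun n : ℕ => (1 / 2 : ℝ) ^ n) atTop (𝓝 0) :=
  tendsto_pow_atTop_nhds_zero_of_lt_one (by norm_num) (by norm_num)

/-- The conjugate `H_n R_{m α_{n+1}} H_n⁻¹`, which is the `m`-th power of `fMap`. -/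
noncomputable def powMap (σ : ℝ) (p : ℕ → ℤ) (q : ℕ → ℕ) (m : ℤ) (n : ℕ) : Equiv.Perm Torus :=
  HMap σ q n * rot (m * ((p (n + 1) : ℝ) / q (n + 1))) * (HMap σ q n)⁻¹

/-- The complexification of `powMap`. -/
noncomputable def powMapC (σ : ℝ) (p : ℕ → ℤ) (q : ℕ → ℕ) (m : ℤ) (n : ℕ) :
    Equiv.Perm (ℂ × ℂ) :=
  HMapC σ q n * rotC (m * ((p (n + 1) : ℝ) / q (n + 1))) * (HMapC σ q n)⁻¹

section Limit

variable {σ : ℝ} {p : ℕ → ℤ} {q : ℕ → ℕ}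

theorem isStripLift_powMap {ρ : ℝ} (hρ : 0 < ρ) (m : ℤ) (n : ℕ) :
    IsStripLift ρ (powMap σ p q m n) (powMapC σ p q m n) :=
  isStripLift_conj (isLift_HMap σ q n).1 (isLift_HMap σ q n).2 _ hρ

theorem isMeasHomeo_powMap (m : ℤ) (n : ℕ) : IsMeasHomeo (powMap σ p q m n) :=
  ((isMeasHomeo_HMap σ q n).mul (isMeasHomeo_rot _)).mul (isMeasHomeo_HMap σ q n).symm

theorem powMap_one (n : ℕ) : powMap σ p q 1 n = fMap σ p q n := by
  simp [powMap, fMap]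

theorem powMap_add_one (m : ℕ) (n : ℕ) :
    powMap σ p q (m + 1 : ℕ) n = powMap σ p q 1 n * powMap σ p q m n := by
  have h : rot (((m + 1 : ℕ) : ℤ) * ((p (n + 1) : ℝ) / q (n + 1))) =
      rot ((1 : ℤ) * ((p (n + 1) : ℝ) / q (n + 1))) *
        rot ((m : ℤ) * ((p (n + 1) : ℝ) / q (n + 1))) := by
    ext1 x
    simp only [rot, Equiv.Perm.mul_apply, Equiv.coe_fn_mk, add_assoc, ← AddCircle.coe_add]
    congr 3
    push_cast
    ring
  simp only [powMap, h]
  group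

theorem powMap_neg_one (n : ℕ) : powMap σ p q (-1) n = (powMap σ p q 1 n)⁻¹ := by
  have h : rot ((-1 : ℤ) * ((p (n + 1) : ℝ) / q (n + 1))) =
      (rot ((1 : ℤ) * ((p (n + 1) : ℝ) / q (n + 1))))⁻¹ := by
    ext1 x
    have : ∀ t : ℝ, (rot t)⁻¹ x = (x.1 - (t : UnitAddCircle), x.2) := fun t => rfl
    rw [this]
    simp [rot, sub_eq_add_neg]
  simp only [powMap, h]
  group

theorem powMap_zero_apply (n : ℕ) (y : Torus) : powMap σ p q (0 : ℕ) n y = y := by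
  have h : rot (((0 : ℕ) : ℤ) * ((p (n + 1) : ℝ) / q (n + 1))) = 1 := by
    ext1 x
    simp [rot]
  simp only [powMap, h]
  simp

/-- The limit diffeomorphism: if the maps `powMapC m n` are fast Cauchy on the strip as long as `m`
is at most the next denominator, then the `fMap`s converge, and the iterates of the limit are
close to those of the approximations. -/
theorem exists_limit {ρ : ℝ} (hρ : 0 < ρ) (hq : ∀ n, 0 < q (n + 1)) (hmono : Monotone q)
    (hstep : ∀ n (m : ℤ), |m| ≤ q (n + 1) → ∀ z ∈ strip ρ,
      ‖powMapC σ p q m (n + 1) z - powMapC σ p q m n z‖ ≤ (1 / 2 : ℝ) ^ (n + 1)) :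
    (∀ n, IsRhoDiffeo ρ (fMap σ p q n)) ∧ ∃ f : Equiv.Perm Torus, IsRhoDiffeo ρ f ∧
      Tendsto (fun n => rhoDist ρ (fMap σ p q n) f) atTop (𝓝 0) ∧
      MeasurePreserving f volume volume ∧
      ∀ n (m : ℕ), m ≤ q (n + 1) → ∀ y, dist (f^[m] y) (powMap σ p q m n y) ≤ (1 / 2 : ℝ) ^ n := by
  have hlift : ∀ m n, IsStripLift ρ (powMap σ p q m n) (powMapC σ p q m n) :=
    isStripLift_powMap hρ
  have hdist : ∀ n (m : ℤ), |m| ≤ q (n + 1) → ∀ y,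
      dist (powMap σ p q m (n + 1) y) (powMap σ p q m n y) ≤ (1 / 2 : ℝ) ^ (n + 1) :=
    fun n m hm y => (hlift m (n + 1)).dist_le hρ (hlift m n) (hstep n m hm) y
  have hone : ∀ n, |(1 : ℤ)| ≤ q (n + 1) := fun n => by
    have := hq n
    simp only [abs_one]
    omega
  have hone' : ∀ n, |(-1 : ℤ)| ≤ q (n + 1) := fun n => by simpa using hone n
  have hex : ∀ m : ℤ, (∀ n, |m| ≤ q (n + 1)) → ∀ y, ∃ w,
      Tendsto (fun n => powMap σ p q m n y) atTop (𝓝 w) := by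
    intro m hm y
    refine cauchySeq_tendsto_of_complete
      (cauchySeq_of_le_geometric (1 / 2) (1 / 2) (by norm_num) fun n => ?_)
    rw [dist_comm, ← pow_succ']
    exact hdist n m (hm n) y
  choose f hf using hex 1 hone
  choose g hg using hex (-1) hone'
  have hunif : ∀ {m : ℤ} {φ : Torus → Torus}, (∀ n, |m| ≤ q (n + 1)) →
      (∀ y, Tendsto (fun n => powMap σ p q m n y) atTop (𝓝 (φ y))) →
      TendstoUniformly (fun n => powMap σ p q m n) φ atTop := by
    intro m φ hm hφ
    rw [Metric.tendstoUniformly_iff]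
    intro ε hε
    filter_upwards [tendsto_half_pow.eventually (gt_mem_nhds hε)] with n hn y
    rw [dist_comm]
    exact (dist_le_half_pow_of_tendsto (fun k _ => hdist k m (hm k) y) (hφ y)).trans_lt hn
  have hfu := hunif hone hf
  have hgu := hunif hone' hg
  have hfc : Continuous f := hfu.continuous
    (Eventually.of_forall fun n => (isMeasHomeo_powMap 1 n).continuous).frequently
  have hgc : Continuous g := hgu.continuous
    (Eventually.of_forall fun n => (isMeasHomeo_powMap (-1) n).continuous).frequently
  -- Uniform convergence allows passing to the limit in the composition of each approximation with
  -- its inverse.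
  have hfg : ∀ y, f (g y) = y := fun y =>
    tendsto_nhds_unique (hfu.tendsto_comp hfc.continuousAt (hg y)) <| by
      simp [powMap_neg_one]
  have hgf : ∀ y, g (f y) = y := fun y =>
    tendsto_nhds_unique (hgu.tendsto_comp hgc.continuousAt (hf y)) <| by
      simp [powMap_neg_one]
  let e : Equiv.Perm Torus := ⟨f, g, hgf, hfg⟩
  obtain ⟨D, hD, hDc⟩ := exists_isStripLift_limit hρ (hlift 1) (fun n => hstep n 1 (hone n)) hf
  obtain ⟨D', hD', -⟩ :=
    exists_isStripLift_limit hρ (hlift (-1)) (fun n => hstep n (-1) (hone' n)) hg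
  refine ⟨fun n => ?_, e, isRhoDiffeo_of_isStripLift hρ (F := e) hD hD', ?_, ?_, ?_⟩
  · rw [← powMap_one]
    refine isRhoDiffeo_of_isStripLift hρ (hlift 1 n) (C' := powMapC σ p q (-1) n) ?_
    have := hlift (-1) n
    rwa [powMap_neg_one] at this
  · have h0 : Tendsto (fun n : ℕ => ENNReal.ofReal ((1 / 2 : ℝ) ^ n)) atTop (𝓝 0) := by
      simpa using ENNReal.tendsto_ofReal tendsto_half_pow
    refine tendsto_of_tendsto_of_tendsto_of_le_of_le tendsto_const_nhds h0 (fun _ => zero_le)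
      fun n => ?_
    simp only [← powMap_one]
    exact rhoDist_le hρ (hlift 1 n) (G := e) hD (hDc n)
  · exact measurePreserving_of_tendsto (fun n => (isMeasHomeo_powMap 1 n).measurePreserving)
      hfc.measurable hf
  · intro n m hm y
    -- Convergence holds for every exponent; only the rate below needs `m ≤ q (n + 1)`, a bound that
    -- persists at later stages because `q` is monotone.
    have hiter : ∀ k : ℕ, Tendsto (fun i => powMap σ p q k i y) atTop (𝓝 (f^[k] y)) := by
      intro k
      induction k with
      | zero =>
        simp only [powMap_zero_apply]
        exact tendsto_const_nhds
      | succ k ih =>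
        rw [Function.iterate_succ_apply']
        simp only [powMap_add_one, Equiv.Perm.mul_apply]
        exact hfu.tendsto_comp hfc.continuousAt ih
    rw [dist_comm]
    refine dist_le_half_pow_of_tendsto (fun k hk => hdist k m ?_ y) (hiter m)
    have : q (n + 1) ≤ q (k + 1) := hmono (by omega)
    rw [Nat.abs_cast]
    exact_mod_cast hm.trans this

end Limit

/-- Stage `n + 1` supplies an exponent `m n` for which the iterate of `f` is close to the
half-period conjugate by `H (n + 1)`. Splitting off the last factor of `H (n + 1)` rewrites this as
`halfShift` conjugated by `H n`, whose mixing was arranged at stage `n`. -/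
theorem isWeakMixing_of_admissible {α δ σ ρ : ℝ} {P : ℕ → ℤ} {Q : ℕ → ℕ} {k : ℕ → ℕ}
    (hk : ∀ n, Admissible α δ σ ρ P Q n (HMap σ (fun i => Q (k i)) n)
      (HMapC σ (fun i => Q (k i)) n) (k n) (k (n + 1))) {f : Torus → Torus}
    (hf : MeasurePreserving f volume volume)
    (hiter : ∀ n (m : ℕ), m ≤ Q (k (n + 1)) → ∀ y,
      dist (f^[m] y) (powMap σ (fun i => P (k i)) (fun i => Q (k i)) m n y) ≤ (1 / 2 : ℝ) ^ n) :
    IsWeakMixing f volume := by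
  choose m hm hmd using fun n => (hk (n + 1)).approx
  set H := HMap σ (fun i => Q (k i)) with hH
  have hG : ∀ n, IsMeasHomeo (H n *
      halfShift ⌊((n + 1 : ℕ) : ℝ) * (Q (k (n + 1)) : ℝ) ^ σ⌋ (Q (k (n + 1))) * (H n)⁻¹) := fun n =>
    ((isMeasHomeo_HMap _ _ n).mul (isMeasHomeo_halfShift _ _)).mul (isMeasHomeo_HMap _ _ n).symm
  set G : ℕ → Equiv.Perm Torus := fun n => H n *
      halfShift ⌊((n + 1 : ℕ) : ℝ) * (Q (k (n + 1)) : ℝ) ^ σ⌋ (Q (k (n + 1))) * (H n)⁻¹ with hGdef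
  have hGeq : ∀ n, H (n + 1) * rot (1 / (2 * Q (k (n + 1)))) * (H (n + 1))⁻¹ = G n := by
    intro n
    have : H (n + 1) = H n * (shear ⌊((n + 1 : ℕ) : ℝ) * (Q (k (n + 1)) : ℝ) ^ σ⌋ *
        phi (Q (k (n + 1)))) := rfl
    rw [this]
    simp only [hGdef, halfShift]
    group
  have hclose : ∀ n y, dist (f^[m n] y) (G n y) ≤ (1 / 2 : ℝ) ^ n := by
    intro n y
    have h1 := hiter (n + 1) (m n) (hm n) y
    have h2 := hmd n y
    rw [hGeq n] at h2
    refine (dist_triangle _ _ _).trans ((add_le_add h1 h2).trans (le_of_eq ?_))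
    ring
  refine isWeakMixing_of_correlation volume hf (l := atTop) (m := m) fun u v => ?_
  refine tendsto_correlation_of_dist_le volume (fun n => (hG n).continuous.measurable)
    (fun n => (hf.iterate (m n)).measurable) tendsto_half_pow (Eventually.of_forall hclose) u v ?_
  refine tendsto_correlation_of_span_dense volume _
    (S := Set.range (TopologicalSpace.denseSeq C(Torus, ℂ))) ?_ ?_ u v
  · rw [← Submodule.dense_iff_topologicalClosure_eq_top]
    exact (TopologicalSpace.denseRange_denseSeq C(Torus, ℂ)).mono Submodule.subset_span
  · rintro _ ⟨a, rfl⟩ _ ⟨b, rfl⟩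
    refine squeeze_zero_norm' ?_ tendsto_half_pow
    filter_upwards [eventually_ge_atTop a, eventually_ge_atTop b] with n ha hb
    exact (hk n).mixing a ha b hb

end TorusConj

/-! ### Assembly of the theorem -/

open TorusConj
theorem theorem2 (α δ σ ρ : ℝ) (hδ : 0 < δ) (hσ : 0 < σ) (hσδ : σ < min (δ / 3) 1) (hρ : 0 < ρ)
    (P : ℕ → ℤ) (Q : ℕ → ℕ)
    (hdistinct : Function.Injective fun j => (P j, Q j))
    (hsol : ∀ j, 0 < Q j ∧ IsCoprime (P j) (Q j : ℤ) ∧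
      |α - (P j : ℝ) / (Q j : ℝ)| < Real.exp (-((Q j : ℝ) ^ (1 + δ)))) :
    ∃ k : ℕ → ℕ, StrictMono k ∧
      StrictMono (fun n => Q (k n)) ∧
      StrictAnti (fun n => |α - (P (k n) : ℝ) / (Q (k n) : ℝ)|) ∧
      (∀ n, IsRhoDiffeo ρ (fMap σ (fun i => P (k i)) (fun i => Q (k i)) n)) ∧
      ∃ f : Equiv.Perm Torus, IsRhoDiffeo ρ f ∧
        Tendsto (fun n => rhoDist ρ (fMap σ (fun i => P (k i)) (fun i => Q (k i)) n) f)
          atTop (𝓝 0) ∧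
        IsWeakMixing f volume := by
  have hQ : Tendsto Q atTop atTop := tendsto_denominators hdistinct fun j =>
    ⟨(hsol j).1, (hsol j).2.2.trans_le (Real.exp_le_one_iff.2 (by
      have : (0 : ℝ) ≤ (Q j : ℝ) ^ (1 + δ) := by positivity
      linarith))⟩
  obtain ⟨k, hk⟩ := exists_dependent_seq
    (Cond := fun n k j => Admissible α δ σ ρ P Q n (HMap σ (fun i => Q (k i)) n)
      (HMapC σ (fun i => Q (k i)) n) (k n) j) (by
      intro n k k' j hkk' h
      have := HMap_congr σ (q := fun i => Q (k i)) (q' := fun i => Q (k' i)) (n := n)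
        fun i hi => congrArg Q (hkk' i hi)
      simpa only [this.1, this.2, hkk' n le_rfl] using h)
    (fun n k => exists_admissible hδ hσ hσδ hρ hQ hsol n _ (k n))
  have hmono : StrictMono fun n => Q (k n) := strictMono_nat_of_lt_succ fun n => (hk n).denom_lt
  have hanti : StrictAnti fun n => |α - (P (k n) : ℝ) / (Q (k n) : ℝ)| :=
    strictAnti_nat_of_succ_lt fun n => (hk n).closer
  refine ⟨k, strictMono_nat_of_lt_succ fun n => (hk n).lt, hmono, hanti, ?_⟩
  have hstep : ∀ n (m : ℤ), |m| ≤ Q (k (n + 1)) → ∀ z ∈ strip ρ,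
      ‖powMapC σ (fun i => P (k i)) (fun i => Q (k i)) m (n + 1) z -
        powMapC σ (fun i => P (k i)) (fun i => Q (k i)) m n z‖ ≤ (1 / 2 : ℝ) ^ (n + 1) := by
    intro n m hm z hz
    -- The later fraction is closer to `α`, so the distance between the two is at most twice the
    -- error of the earlier one; this is the factor 2 in `perturb`.
    refine (hk n).perturb ((P (k (n + 2)) : ℝ) / Q (k (n + 2))) ?_ m hm z hz
    have h1 := hanti (Nat.lt_succ_self (n + 1))
    have h2 := (hsol (k (n + 1))).2.2
    have h3 := abs_sub_le ((P (k (n + 2)) : ℝ) / Q (k (n + 2))) α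
      ((P (k (n + 1)) : ℝ) / Q (k (n + 1)))
    rw [abs_sub_comm _ α] at h3
    simp only at h1
    linarith
  obtain ⟨h1, f, hf, hlim, hmp, hiter⟩ :=
    exists_limit hρ (fun n => (hsol (k (n + 1))).1) hmono.monotone hstep
  exact ⟨h1, f, hf, hlim, isWeakMixing_of_admissible hk hmp hiter⟩
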